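/- Let $\mathcal P_2(\mathbb R^p)$ be the set of Borel probability measures on $\mathbb R^p$ with finite second moment, let $W_2$ be the 2-Wasserstein distance, and let $\Pi_o(\mu,\nu)$ be the set of couplings of $\mu,\nu$ that are optimal for the cost $\|x-y\|^2$. For $\mathcal G:\mathcal P_2(\mathbb R^p)\to\mathbb R$, a field $\xi\in L^2(\mu)$ belongs to $\partial^-\mathcal G(\mu)$ if $$\mathcal G(\nu)\ge \mathcal G(\mu)+\sup_{\gamma\in\Pi_o(\mu,\nu)}\int\langle \xi(x),y-x\rangle\,\mathrm d\gamma(x,y)+o(W_2(\mu,\nu))$$ as $W_2(\mu,\nu)\to0$, and to $\partial^+\mathcal G(\mu)$ if $-\xi\in\partial^-(-\mathcal G)(\mu)$. The Wasserstein gradient $\nabla_W\mathcal G(\mu)$, if it exists, is the element of $\partial^-\mathcal G(\mu)\cap\partial^+\mathcal G(\mu)$ that lies in the tangent space at $\mu$, i.e. in the $L^2(\mu)$-closure of $\{\nabla\psi:\psi\in C_c^\infty(\mathbb R^p)\}$; it is determined up to $\mu$-null sets. A first variation $\frac{\delta\mathcal G}{\delta\mu}(\mu)$ is a function $\varphi:\mathbb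 R^p\to\mathbb R$, integrable with respect to every measure in $\mathcal P_2(\mathbb R^p)$, such that for every $\nu\in\mathcal P_2(\mathbb R^p)$, with $\chi=\nu-\mu$, $$\lim_{t\to0^+}\frac{\mathcal G(\mu+t\chi)-\mathcal G(\mu)}{t}=\int\varphi\,\mathrm d\chi .$$ Let $\mu\in\mathcal P_2(\mathbb R^p)$ and $\mathcal F:\mathcal P_2(\mathbb R^p)\to\mathbb R$. Let $T:\mathbb R^p\to\mathbb R^p$ be Lipschitz (that is, $\nabla T$ is bounded in operator norm, in the weak sense) and differentiable $\mu$-almost everywhere, and put $\tilde{\mathcal F}(\nu):=\mathcal F(T_\#\nu)$ for $\nu\in\mathcal P_2(\mathbb R^p)$. Write $\nabla T(x)$ for the transpose of the Jacobian matrix of $T$ at $x$. Suppose that $\mathcal F$ has a Wasserstein gradient at $T_\#\mu$. Then $\tilde{\mathcal F}$ has a Wasserstein gradient at $\mu$, and $\mu$-almost everywhere $$\nabla_W\tilde{\mathcal F}(\mu)=\nabla T\cdot\big(\nabla_W\mathcal F(T_\#\mu)\circ T\big).$$ Moreover, let $\varphi=\frac{\delta\mathcal F}{\delta\mu}(T_\#\mu)$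 be a first variation of $\mathcal F$ at $T_\#\mu$ that is differentiable $T_\#\mu$-almost everywhere, and suppose that $T_\#\mu$ has a $C^1$ density with respect to Lebesgue measure or that $\nabla\varphi$ is the Wasserstein gradient of $\mathcal F$ at $T_\#\mu$. Then $\varphi\circ T$ is differentiable $\mu$-almost everywhere, and $\mu$-almost everywhere $$\nabla_W\tilde{\mathcal F}(\mu)=\nabla\Big(\tfrac{\delta\mathcal F}{\delta\mu}(T_\#\mu)\circ T\Big).$$ -/

import Mathlib

open MeasureTheory Filter Topology

/-- The Borel probability measures on `ℝ^p` with finite second moment. -/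
def P2 (p : ℕ) : Type :=
  {μ : Measure (EuclideanSpace ℝ (Fin p)) //
    IsProbabilityMeasure μ ∧ Integrable (fun x => ‖x‖ ^ 2) μ}

namespace P2

variable {p : ℕ}

/-- The push-forward `T_# μ` of `μ` under a Lipschitz map. -/
noncomputable def map (T : EuclideanSpace ℝ (Fin p) → EuclideanSpace ℝ (Fin p)) {K : NNReal}
    (hT : LipschitzWith K T) (μ : P2 p) : P2 p :=
  ⟨μ.1.map T, by
    obtain ⟨μ, hμ, hμ2⟩ := μ
    have hTm : Measurable T := hT.continuous.measurable
    refine ⟨Measure.isProbabilityMeasure_map hTm.aemeasurable, ?_⟩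
    rw [integrable_map_measure (by fun_prop) hTm.aemeasurable]
    refine Integrable.mono' (g := fun x => 2 * ‖T 0‖ ^ 2 + 2 * (K : ℝ) ^ 2 * ‖x‖ ^ 2)
      ((integrable_const _).add (hμ2.const_mul _)) ?_ ?_
    · exact ((hT.continuous.norm.pow 2).aestronglyMeasurable)
    · refine Eventually.of_forall fun x => ?_
      have h1 : ‖T x - T 0‖ ≤ K * ‖x‖ := by
        simpa [dist_eq_norm] using hT.dist_le_mul x 0
      have h2 : ‖T x‖ ≤ ‖T x - T 0‖ + ‖T 0‖ := by
        simpa using norm_add_le (T x - T 0) (T 0)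
      have h3 : ‖T x‖ ≤ K * ‖x‖ + ‖T 0‖ := by linarith
      have h4 : ‖T x‖ ^ 2 ≤ (K * ‖x‖ + ‖T 0‖) ^ 2 := by gcongr
      simp only [Function.comp, norm_pow, norm_norm]
      nlinarith [sq_nonneg (K * ‖x‖ - ‖T 0‖)]⟩

/-- The mixture `(1 - t) μ + t ν = μ + t (ν - μ)` for `t ∈ [0, 1]`. -/
noncomputable def mix (μ ν : P2 p) (t : unitInterval) : P2 p :=
  ⟨ENNReal.ofReal (1 - t) • μ.1 + ENNReal.ofReal t • ν.1, by
    obtain ⟨μ, hμ, hμ2⟩ := μ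
    obtain ⟨ν, hν, hν2⟩ := ν
    refine ⟨⟨?_⟩, ?_⟩
    · simp only [Measure.add_apply, Measure.smul_apply, measure_univ, smul_eq_mul, mul_one]
      rw [← ENNReal.ofReal_add (by linarith [t.2.2]) t.2.1]
      simp
    · exact (hμ2.smul_measure ENNReal.ofReal_ne_top).add_measure
        (hν2.smul_measure ENNReal.ofReal_ne_top)⟩

/-- `μ` has a continuously differentiable density with respect to Lebesgue measure. -/
def HasC1Density (μ : P2 p) : Prop :=
  ∃ ρ : EuclideanSpace ℝ (Fin p) → ℝ, ContDiff ℝ 1 ρ ∧ (∀ x, 0 ≤ ρ x) ∧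
    μ.1 = volume.withDensity (fun x => ENNReal.ofReal (ρ x))

end P2

/-- The set `Π(μ, ν)` of couplings of `μ` and `ν`. Second moments of a coupling are finite because
those of its marginals are. -/
def couplings {p : ℕ} (μ ν : P2 p) :
    Set (Measure (EuclideanSpace ℝ (Fin p) × EuclideanSpace ℝ (Fin p))) :=
  {γ | γ.map Prod.fst = μ.1 ∧ γ.map Prod.snd = ν.1}

/-- The quadratic cost `∫ ‖x - y‖² dγ(x, y)` of a plan. -/
noncomputable def transportCost {p : ℕ}
    (γ : Measure (EuclideanSpace ℝ (Fin p) × EuclideanSpace ℝ (Fin p))) : ℝ :=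
  ∫ z, ‖z.1 - z.2‖ ^ 2 ∂γ

/-- The set `Π_o(μ, ν)` of optimal couplings for the quadratic cost. -/
def optimalCouplings {p : ℕ} (μ ν : P2 p) :
    Set (Measure (EuclideanSpace ℝ (Fin p) × EuclideanSpace ℝ (Fin p))) :=
  {γ | γ ∈ couplings μ ν ∧ ∀ γ' ∈ couplings μ ν, transportCost γ ≤ transportCost γ'}

/-- The 2-Wasserstein distance. -/
noncomputable def W2 {p : ℕ} (μ ν : P2 p) : ℝ :=
  Real.sqrt (sInf (transportCost '' couplings μ ν))

/-- `ξ ∈ ∂⁻G(μ)`: `ξ ∈ L²(μ)` and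
`G(ν) ≥ G(μ) + sup_{γ ∈ Π_o(μ, ν)} ∫ ⟨ξ(x), y - x⟩ dγ(x, y) + o(W₂(μ, ν))`. -/
def IsSubgradient {p : ℕ} (G : P2 p → ℝ) (μ : P2 p)
    (ξ : EuclideanSpace ℝ (Fin p) → EuclideanSpace ℝ (Fin p)) : Prop :=
  MemLp ξ 2 μ.1 ∧
    ∀ ε > 0, ∃ δ > 0, ∀ ν : P2 p, W2 μ ν < δ → ∀ γ ∈ optimalCouplings μ ν,
      G μ + ∫ z, inner ℝ (ξ z.1) (z.2 - z.1) ∂γ - ε * W2 μ ν ≤ G ν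

/-- `ξ ∈ ∂⁺G(μ)`, that is, `-ξ ∈ ∂⁻(-G)(μ)`. -/
def IsSupergradient {p : ℕ} (G : P2 p → ℝ) (μ : P2 p)
    (ξ : EuclideanSpace ℝ (Fin p) → EuclideanSpace ℝ (Fin p)) : Prop :=
  IsSubgradient (fun ν => -G ν) μ (fun x => -ξ x)

/-- `ξ` lies in the tangent space at `μ`, the `L²(μ)`-closure of the gradients of smooth compactly
supported functions. -/
def InTangentSpace {p : ℕ} (μ : P2 p)
    (ξ : EuclideanSpace ℝ (Fin p) → EuclideanSpace ℝ (Fin p)) : Prop :=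
  MemLp ξ 2 μ.1 ∧
    ∀ ε : ENNReal, 0 < ε → ∃ ψ : EuclideanSpace ℝ (Fin p) → ℝ,
      ContDiff ℝ (⊤ : ℕ∞) ψ ∧ HasCompactSupport ψ ∧
        eLpNorm (fun x => ξ x - gradient ψ x) 2 μ.1 < ε

/-- `ξ` is (a representative of) the Wasserstein gradient of `G` at `μ`: the element of
`∂⁻G(μ) ∩ ∂⁺G(μ)` that lies in the tangent space at `μ`. -/
def IsWassersteinGradient {p : ℕ} (G : P2 p → ℝ) (μ : P2 p)
    (ξ : EuclideanSpace ℝ (Fin p) → EuclideanSpace ℝ (Fin p)) : Prop :=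
  IsSubgradient G μ ξ ∧ IsSupergradient G μ ξ ∧ InTangentSpace μ ξ

/-- `φ` is a first variation of `G` at `μ`:
`lim_{t → 0+} (G(μ + t χ) - G(μ)) / t = ∫ φ dχ` for all perturbations `χ = ν - μ`. A signed measure
`χ` with `μ + t χ ∈ P2` for some `t > 0` is a positive multiple of such a difference. -/
def IsFirstVariation {p : ℕ} (G : P2 p → ℝ) (μ : P2 p)
    (φ : EuclideanSpace ℝ (Fin p) → ℝ) : Prop :=
  (∀ ν : P2 p, Integrable φ ν.1) ∧
    ∀ ν : P2 p,
      Tendsto (fun t : unitInterval => (G (P2.mix μ ν t) - G μ) / (t : ℝ)) (𝓝[>] 0)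
        (𝓝 ((∫ x, φ x ∂ν.1) - ∫ x, φ x ∂μ.1))

/-!
The key notion is that of a *strong gradient*: a field `ξ ∈ L²(μ)` such that
`G(ν) = G(μ) + ∫ ⟨ξ(x), y - x⟩ dγ + o(√cost(γ))` along **every** coupling `γ` of `μ` and `ν`, not
only the optimal ones. A Wasserstein gradient is a strong gradient
(`IsWassersteinGradient.isStrongGradient`): for a test function `ψ`, Taylor's formula gives
`∫ ⟨∇ψ(x), y - x⟩ dγ = ∫ ψ dν - ∫ ψ dμ + O(cost(γ))`, so that for fields in the closure of such
gradients the pairing with `γ` can be compared with the pairing with an optimal coupling. Optimal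
couplings exist by Prokhorov's theorem and lower semicontinuity of the cost
(`exists_mem_optimalCouplings`); without them subgradients would carry no information. Conversely
a tangent strong gradient is a Wasserstein gradient, and transporting `μ` along `x ↦ x + t ∇ψ(x)`
shows that there is at most one (`IsWassersteinGradient.ae_eq`).

*Chain rule.* A coupling `γ` of `μ` and `ν` pushes forward under `T × T` to a coupling of `T_# μ`
and `T_# ν`, which need not be optimal but whose cost is at most `K²` times as large. Hence the
strong expansion of `F` at `T_# μ` gives one of `F ∘ T_#` at `μ`, once `T(y) - T(x)` is replaced by
`DT(x)(y - x)`; the error is `o(√cost)` by `exists_abs_integral_inner_remainder_le`. The field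
`DTᵀ (ξ ∘ T)` is tangent because it is a limit of the fields `DTᵀ (∇ψ ∘ T) = ∇(ψ ∘ T)`, and the
gradient of a bounded Lipschitz function that is differentiable `μ`-almost everywhere is tangent, by
mollification and truncation (`inTangentSpace_gradient_of_lipschitzWith`).

*First variation.* It remains to see that `ξ = ∇φ` almost everywhere when `T_# μ` has a continuous
density `ρ`. Let `h ≥ 0` be a test function supported in `{ρ > 0}`, small compared with `ρ`. The
densities `ρ` and `ρ - t ∂ᵥh` admit a coupling of cost `O(t²)`: translating the mass `h` by `t v`
changes the density by `h(· - t v) - h = -t ∂ᵥh + O(t²)`, and the discrepancy of mass `O(t²)` can be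
transported arbitrarily within a bounded set (`IsTransportBump.exists_coupling`). Differentiating
`F` along this segment with the strong gradient and with the first variation gives
`-∫ φ ∂ᵥh = ∫ h ⟨ξ, v⟩`, that is, `ξ` is the weak gradient of `φ` on `{ρ > 0}`. Taking for `h` a
mollifier centred at `x`, the left side tends to `⟨∇φ(x), v⟩` if `φ` is differentiable at `x`, and
the right side to `⟨ξ(x), v⟩` at Lebesgue points (`IsStrongGradient.ae_eq_gradient`).
-/

section WassersteinGradient

/-! ### Couplings and optimal transport plans -/

/-- **Cauchy–Schwarz** for vector fields in `L²`. -/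
theorem abs_integral_inner_le {α E : Type*} [MeasurableSpace α] [NormedAddCommGroup E]
    [InnerProductSpace ℝ E] {γ : Measure α} {f g : α → E} (hf : MemLp f 2 γ) (hg : MemLp g 2 γ) :
    |∫ z, inner ℝ (f z) (g z) ∂γ| ≤ (eLpNorm f 2 γ).toReal * (eLpNorm g 2 γ).toReal := by
  have h := norm_inner_le_norm (𝕜 := ℝ) (hf.toLp f) (hg.toLp g)
  rw [MeasureTheory.L2.inner_def, Lp.norm_toLp, Lp.norm_toLp, Real.norm_eq_abs] at h
  refine le_trans (le_of_eq ?_) h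
  congr 1
  refine integral_congr_ae ?_
  filter_upwards [hf.coeFn_toLp, hg.coeFn_toLp] with z h1 h2
  rw [h1, h2]

theorem integrable_inner_of_memLp {α E : Type*} [MeasurableSpace α] [NormedAddCommGroup E]
    [InnerProductSpace ℝ E] {γ : Measure α} {f g : α → E} (hf : MemLp f 2 γ) (hg : MemLp g 2 γ) :
    Integrable (fun z => inner ℝ (f z) (g z)) γ := by
  have h := MeasureTheory.L2.integrable_inner (𝕜 := ℝ) (hf.toLp f) (hg.toLp g)
  refine h.congr ?_
  filter_upwards [hf.coeFn_toLp, hg.coeFn_toLp] with z h1 h2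
  rw [h1, h2]

theorem integral_norm_sq_eq_eLpNorm_sq {α E : Type*} [MeasurableSpace α] [NormedAddCommGroup E]
    [InnerProductSpace ℝ E] {γ : Measure α} {f : α → E} (hf : MemLp f 2 γ) :
    ∫ z, ‖f z‖ ^ 2 ∂γ = (eLpNorm f 2 γ).toReal ^ 2 := by
  have h := real_inner_self_eq_norm_sq (hf.toLp f)
  rw [MeasureTheory.L2.inner_def, Lp.norm_toLp] at h
  rw [← h]
  refine integral_congr_ae ?_
  filter_upwards [hf.coeFn_toLp] with z h1
  rw [h1, real_inner_self_eq_norm_sq]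

variable {p : ℕ}

local notation "𝔼" => EuclideanSpace ℝ (Fin p)

instance (μ : P2 p) : IsProbabilityMeasure μ.1 := μ.2.1

theorem P2.memLp_id (μ : P2 p) : MemLp (fun x => x) 2 μ.1 := by
  rw [memLp_two_iff_integrable_sq_norm (by fun_prop)]
  exact μ.2.2

section Couplings

variable {μ ν : P2 p} {γ : Measure (EuclideanSpace ℝ (Fin p) × EuclideanSpace ℝ (Fin p))}

theorem measurePreserving_fst_of_mem_couplings (hγ : γ ∈ couplings μ ν) :
    MeasurePreserving Prod.fst γ μ.1 := ⟨measurable_fst, hγ.1⟩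

theorem measurePreserving_snd_of_mem_couplings (hγ : γ ∈ couplings μ ν) :
    MeasurePreserving Prod.snd γ ν.1 := ⟨measurable_snd, hγ.2⟩

theorem isProbabilityMeasure_of_mem_couplings (hγ : γ ∈ couplings μ ν) :
    IsProbabilityMeasure γ := by
  constructor
  have := (measurePreserving_fst_of_mem_couplings hγ).measure_preimage
    MeasurableSet.univ.nullMeasurableSet
  simpa using this

theorem memLp_displacement (hγ : γ ∈ couplings μ ν) : MemLp (fun z => z.2 - z.1) 2 γ :=
  (ν.memLp_id.comp_measurePreserving (measurePreserving_snd_of_mem_couplings hγ)).sub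
    (μ.memLp_id.comp_measurePreserving (measurePreserving_fst_of_mem_couplings hγ))

theorem memLp_comp_fst (hγ : γ ∈ couplings μ ν) {ξ : 𝔼 → 𝔼} (hξ : MemLp ξ 2 μ.1) :
    MemLp (fun z => ξ z.1) 2 γ :=
  hξ.comp_measurePreserving (measurePreserving_fst_of_mem_couplings hγ)

theorem eLpNorm_comp_fst (hγ : γ ∈ couplings μ ν) {ξ : 𝔼 → 𝔼} (hξ : MemLp ξ 2 μ.1) :
    eLpNorm (fun z => ξ z.1) 2 γ = eLpNorm ξ 2 μ.1 :=
  eLpNorm_comp_measurePreserving hξ.1 (measurePreserving_fst_of_mem_couplings hγ)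

theorem transportCost_nonneg : 0 ≤ transportCost γ := integral_nonneg fun _ => sq_nonneg _

theorem sqrt_transportCost (hγ : γ ∈ couplings μ ν) :
    √(transportCost γ) = (eLpNorm (fun z => z.2 - z.1) 2 γ).toReal := by
  rw [Real.sqrt_eq_iff_eq_sq transportCost_nonneg ENNReal.toReal_nonneg,
    ← integral_norm_sq_eq_eLpNorm_sq (memLp_displacement hγ)]
  simp only [transportCost, norm_sub_rev]

theorem integrable_displacement_sq (hγ : γ ∈ couplings μ ν) :
    Integrable (fun z => ‖z.2 - z.1‖ ^ 2) γ :=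
  (memLp_displacement hγ).integrable_norm_pow two_ne_zero

theorem abs_integral_inner_displacement_le (hγ : γ ∈ couplings μ ν) {ξ : 𝔼 → 𝔼}
    (hξ : MemLp ξ 2 μ.1) :
    |∫ z, inner ℝ (ξ z.1) (z.2 - z.1) ∂γ| ≤
      (eLpNorm ξ 2 μ.1).toReal * √(transportCost γ) := by
  rw [sqrt_transportCost hγ, ← eLpNorm_comp_fst hγ hξ]
  exact abs_integral_inner_le (memLp_comp_fst hγ hξ) (memLp_displacement hγ)

theorem W2_le_sqrt_transportCost (hγ : γ ∈ couplings μ ν) : W2 μ ν ≤ √(transportCost γ) :=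
  Real.sqrt_le_sqrt (csInf_le ⟨0, by rintro _ ⟨γ', -, rfl⟩; exact transportCost_nonneg⟩
    ⟨γ, hγ, rfl⟩)

theorem W2_eq_of_mem_optimalCouplings (hγ : γ ∈ optimalCouplings μ ν) :
    W2 μ ν = √(transportCost γ) := by
  rw [W2]
  congr 1
  refine IsLeast.csInf_eq ⟨⟨γ, hγ.1, rfl⟩, ?_⟩
  rintro _ ⟨γ', h', rfl⟩
  exact hγ.2 γ' h'

theorem transportCost_eq_toReal_lintegral (γ : Measure (𝔼 × 𝔼)) :
    transportCost γ = (∫⁻ z, ENNReal.ofReal (‖z.1 - z.2‖ ^ 2) ∂γ).toReal := by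
  rw [transportCost, integral_eq_lintegral_of_nonneg_ae]
  · exact Eventually.of_forall fun _ => sq_nonneg _
  · fun_prop

theorem lintegral_cost_ne_top (hγ : γ ∈ couplings μ ν) :
    ∫⁻ z, ENNReal.ofReal (‖z.1 - z.2‖ ^ 2) ∂γ ≠ ⊤ := by
  have h := integrable_displacement_sq hγ
  simp_rw [norm_sub_rev] at h
  have := h.lintegral_lt_top
  exact this.ne

/-- The quadratic cost of a plan, with values in `[0, ∞]`, is lower semicontinuous for the weak
topology, as the supremum of the integrals of its truncations. -/
theorem lowerSemicontinuous_lintegral_cost :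
    LowerSemicontinuous fun γ : ProbabilityMeasure (𝔼 × 𝔼) =>
      ∫⁻ z, ENNReal.ofReal (‖z.1 - z.2‖ ^ 2) ∂(γ : Measure (𝔼 × 𝔼)) := by
  let c (n : ℕ) : BoundedContinuousFunction (𝔼 × 𝔼) NNReal :=
    BoundedContinuousFunction.mkOfBound
      ⟨fun z => min (Real.toNNReal (‖z.1 - z.2‖ ^ 2)) n, by fun_prop⟩ n (by
        intro x y
        have h (w : 𝔼 × 𝔼) : ((min (Real.toNNReal (‖w.1 - w.2‖ ^ 2)) (n : NNReal) : NNReal) : ℝ) ∈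
            Set.Icc (0 : ℝ) n := ⟨NNReal.coe_nonneg _, mod_cast min_le_right _ _⟩
        simpa [NNReal.dist_eq, Real.dist_eq] using Real.dist_le_of_mem_Icc (h x) (h y))
  have hc (n : ℕ) (z : 𝔼 × 𝔼) : c n z = min (Real.toNNReal (‖z.1 - z.2‖ ^ 2)) n := rfl
  have key : (fun γ : ProbabilityMeasure (𝔼 × 𝔼) =>
      ∫⁻ z, ENNReal.ofReal (‖z.1 - z.2‖ ^ 2) ∂(γ : Measure (𝔼 × 𝔼))) =
      fun γ : ProbabilityMeasure (𝔼 × 𝔼) => ⨆ n, ∫⁻ z, c n z ∂(γ : Measure (𝔼 × 𝔼)) := by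
    ext γ
    rw [← lintegral_iSup (fun n => by fun_prop)]
    · congr 1
      ext z
      refine le_antisymm ?_ (iSup_le fun n => ?_)
      · obtain ⟨n, hn⟩ := exists_nat_ge (Real.toNNReal (‖z.1 - z.2‖ ^ 2))
        refine le_iSup_of_le n ?_
        rw [hc, min_eq_left hn]
        rfl
      · rw [hc]
        exact ENNReal.coe_le_coe.2 (min_le_left _ _)
    · intro m n hmn z
      simp only [hc]
      gcongr
  rw [key]
  refine lowerSemicontinuous_iSup fun n => Continuous.lowerSemicontinuous ?_
  rw [continuous_iff_continuousAt]
  intro γ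
  exact (ProbabilityMeasure.tendsto_iff_forall_lintegral_tendsto.1 tendsto_id) (c n)

theorem prod_mem_couplings (μ ν : P2 p) : μ.1.prod ν.1 ∈ couplings μ ν :=
  ⟨by simp, by simp⟩

/-- Optimal couplings exist: the couplings form a compact set by Prokhorov's theorem, and the cost
is lower semicontinuous. -/
theorem exists_mem_optimalCouplings (μ ν : P2 p) : ∃ γ, γ ∈ optimalCouplings μ ν := by
  let S : Set (ProbabilityMeasure (𝔼 × 𝔼)) := {γ | (γ : Measure (𝔼 × 𝔼)) ∈ couplings μ ν}
  have hclosed : IsClosed S := by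
    have h1 : IsClosed {γ : ProbabilityMeasure (𝔼 × 𝔼) |
        γ.map (continuous_fst.measurable.aemeasurable) = ⟨μ.1, inferInstance⟩} :=
      isClosed_singleton.preimage (ProbabilityMeasure.continuous_map continuous_fst)
    have h2 : IsClosed {γ : ProbabilityMeasure (𝔼 × 𝔼) |
        γ.map (continuous_snd.measurable.aemeasurable) = ⟨ν.1, inferInstance⟩} :=
      isClosed_singleton.preimage (ProbabilityMeasure.continuous_map continuous_snd)
    convert h1.inter h2 using 1
    ext γ
    exact ⟨fun h => ⟨Subtype.ext h.1, Subtype.ext h.2⟩,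
      fun h => ⟨congrArg Subtype.val h.1, congrArg Subtype.val h.2⟩⟩
  have htight :
      IsTightMeasureSet {((γ : ProbabilityMeasure (𝔼 × 𝔼)) : Measure (𝔼 × 𝔼)) | γ ∈ S} := by
    refine IsTightMeasureSet.prodMk ?_ ?_
    · refine (isTightMeasureSet_singleton (μ := μ.1)).subset ?_
      rintro _ ⟨_, ⟨γ, hγ, rfl⟩, rfl⟩
      exact hγ.1
    · refine (isTightMeasureSet_singleton (μ := ν.1)).subset ?_
      rintro _ ⟨_, ⟨γ, hγ, rfl⟩, rfl⟩
      exact hγ.2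
  have hcompact : IsCompact S := by
    have := isCompact_closure_of_isTightMeasureSet htight
    rwa [hclosed.closure_eq] at this
  have hne : S.Nonempty := ⟨⟨μ.1.prod ν.1, inferInstance⟩, prod_mem_couplings μ ν⟩
  obtain ⟨γ, hγ, hmin⟩ := LowerSemicontinuousOn.exists_isMinOn hne hcompact
    ((lowerSemicontinuous_lintegral_cost (p := p)).lowerSemicontinuousOn _)
  refine ⟨γ, hγ, fun γ' hγ' => ?_⟩
  have := isProbabilityMeasure_of_mem_couplings hγ'
  rw [transportCost_eq_toReal_lintegral, transportCost_eq_toReal_lintegral]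
  exact ENNReal.toReal_mono (lintegral_cost_ne_top hγ')
    (hmin (show (⟨γ', this⟩ : ProbabilityMeasure (𝔼 × 𝔼)) ∈ S from hγ'))

end Couplings

/-! ### Strong gradients -/

/-- Taylor's formula with a remainder that is uniformly quadratic. -/
theorem exists_taylor_bound_of_hasCompactSupport {E : Type*} [NormedAddCommGroup E]
    [NormedSpace ℝ E] {ψ : E → ℝ} (hψ : ContDiff ℝ (⊤ : ℕ∞) ψ)
    (hc : HasCompactSupport ψ) :
    ∃ C : ℝ, 0 ≤ C ∧ ∀ x y, |ψ y - ψ x - fderiv ℝ ψ x (y - x)| ≤ C * ‖y - x‖ ^ 2 := by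
  have h1 : ContDiff ℝ 1 (fderiv ℝ ψ) := hψ.fderiv_right (by norm_cast)
  obtain ⟨C, hC⟩ := h1.lipschitzWith_of_hasCompactSupport (hc.fderiv ℝ) one_ne_zero
  refine ⟨C, C.2, fun x y => ?_⟩
  have := (convex_segment x y).norm_image_sub_le_of_norm_fderiv_le' (𝕜 := ℝ) (f := ψ)
    (φ := fderiv ℝ ψ x) (C := C * ‖y - x‖)
    (fun z _ => (hψ.differentiable (by norm_cast)).differentiableAt)
    (fun z hz => ?_) (left_mem_segment ℝ x y) (right_mem_segment ℝ x y)
  · rw [Real.norm_eq_abs] at this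
    calc _ ≤ _ := this
      _ = _ := by ring
  · refine (hC.norm_sub_le z x).trans ?_
    gcongr
    have := norm_sub_le_of_mem_segment hz
    exact this

theorem continuous_gradient_of_contDiff {ψ : 𝔼 → ℝ} (hψ : ContDiff ℝ (⊤ : ℕ∞) ψ) :
    Continuous (gradient ψ) :=
  (InnerProductSpace.toDual ℝ 𝔼).symm.continuous.comp (hψ.continuous_fderiv (by simp))

theorem inner_gradient_eq_fderiv (ψ : 𝔼 → ℝ) (x v : 𝔼) :
    inner ℝ (gradient ψ x) v = fderiv ℝ ψ x v := by
  simp [gradient]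

theorem hasCompactSupport_gradient {ψ : 𝔼 → ℝ} (hc : HasCompactSupport ψ) :
    HasCompactSupport (gradient ψ) :=
  (hc.fderiv ℝ).comp_left (g := (InnerProductSpace.toDual ℝ 𝔼).symm) (map_zero _)

theorem memLp_gradient {ψ : 𝔼 → ℝ} (hψ : ContDiff ℝ (⊤ : ℕ∞) ψ) (hc : HasCompactSupport ψ)
    (μ : P2 p) : MemLp (gradient ψ) 2 μ.1 :=
  (continuous_gradient_of_contDiff hψ).memLp_of_hasCompactSupport (hasCompactSupport_gradient hc)

/-- Up to an error of the order of the cost, the integral of `⟨∇ψ(x), y - x⟩` against a coupling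
depends only on its marginals. -/
theorem exists_bound_integral_gradient {ψ : 𝔼 → ℝ} (hψ : ContDiff ℝ (⊤ : ℕ∞) ψ)
    (hc : HasCompactSupport ψ) :
    ∃ C : ℝ, 0 ≤ C ∧ ∀ (μ ν : P2 p), ∀ γ ∈ couplings μ ν,
      |∫ z, inner ℝ (gradient ψ z.1) (z.2 - z.1) ∂γ - (∫ x, ψ x ∂ν.1 - ∫ x, ψ x ∂μ.1)| ≤
        C * transportCost γ := by
  obtain ⟨C, hC0, hC⟩ := exists_taylor_bound_of_hasCompactSupport hψ hc
  refine ⟨C, hC0, fun μ ν γ hγ => ?_⟩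
  have hfst := measurePreserving_fst_of_mem_couplings hγ
  have hsnd := measurePreserving_snd_of_mem_couplings hγ
  have hi (κ : P2 p) : Integrable ψ κ.1 := hψ.continuous.integrable_of_hasCompactSupport hc
  have h1 : Integrable (fun z : 𝔼 × 𝔼 => ψ z.1) γ := hfst.integrable_comp_of_integrable (hi μ)
  have h2 : Integrable (fun z : 𝔼 × 𝔼 => ψ z.2) γ := hsnd.integrable_comp_of_integrable (hi ν)
  have h3 := integrable_inner_of_memLp (memLp_comp_fst hγ (memLp_gradient hψ hc μ))
    (memLp_displacement hγ)
  have e1 : ∫ x, ψ x ∂μ.1 = ∫ z, ψ z.1 ∂γ := by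
    rw [← hγ.1, integral_map (by fun_prop) hψ.continuous.aestronglyMeasurable]
  have e2 : ∫ x, ψ x ∂ν.1 = ∫ z, ψ z.2 ∂γ := by
    rw [← hγ.2, integral_map (by fun_prop) hψ.continuous.aestronglyMeasurable]
  have h4 : Integrable (fun z : 𝔼 × 𝔼 => ψ z.2 - ψ z.1) γ := h2.sub h1
  rw [e1, e2, ← integral_sub h2 h1, ← integral_sub h3 h4, ← Real.norm_eq_abs]
  have e3 : C * transportCost γ = ∫ z, C * ‖z.2 - z.1‖ ^ 2 ∂γ := by
    rw [integral_const_mul, transportCost]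
    simp_rw [norm_sub_rev]
  rw [e3]
  refine norm_integral_le_of_norm_le ((integrable_displacement_sq hγ).const_mul C)
    (Eventually.of_forall fun z => ?_)
  rw [Real.norm_eq_abs, abs_sub_comm, inner_gradient_eq_fderiv]
  exact hC z.1 z.2

/-- `ξ` is a strong gradient of `G` at `μ` if the first-order expansion
`G(ν) = G(μ) + ∫ ⟨ξ(x), y - x⟩ dγ + o(√cost(γ))` holds along all couplings `γ` of `μ` and `ν`,
optimal or not. -/
def IsStrongGradient (G : P2 p → ℝ) (μ : P2 p) (ξ : 𝔼 → 𝔼) : Prop :=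
  MemLp ξ 2 μ.1 ∧
    ∀ ε > 0, ∃ δ > 0, ∀ ν : P2 p, ∀ γ ∈ couplings μ ν, √(transportCost γ) < δ →
      |G ν - G μ - ∫ z, inner ℝ (ξ z.1) (z.2 - z.1) ∂γ| ≤ ε * √(transportCost γ)

/-- For a tangent field, the pairings with any two couplings of the same measures agree up to
`o(√cost)`. -/
theorem InTangentSpace.exists_abs_sub_le {μ : P2 p} {ξ : 𝔼 → 𝔼} (h : InTangentSpace μ ξ)
    {ε : ℝ} (hε : 0 < ε) :
    ∃ δ > 0, ∀ ν : P2 p, ∀ γ ∈ couplings μ ν, ∀ γ' ∈ couplings μ ν,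
      transportCost γ' ≤ transportCost γ → √(transportCost γ) < δ →
      |∫ z, inner ℝ (ξ z.1) (z.2 - z.1) ∂γ' - ∫ z, inner ℝ (ξ z.1) (z.2 - z.1) ∂γ| ≤
        ε * √(transportCost γ) := by
  obtain ⟨hξ, hap⟩ := h
  obtain ⟨ψ, hψ, hc, hlt⟩ := hap (ENNReal.ofReal (ε / 4)) (by simpa using hε)
  obtain ⟨C, hC0, hC⟩ := exists_bound_integral_gradient hψ hc
  refine ⟨ε / (4 * (C + 1)), by positivity, fun ν γ hγ γ' hγ' hle hδ => ?_⟩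
  have hη : MemLp (fun x => ξ x - gradient ψ x) 2 μ.1 := hξ.sub (memLp_gradient hψ hc μ)
  have hN : (eLpNorm (fun x => ξ x - gradient ψ x) 2 μ.1).toReal ≤ ε / 4 :=
    (ENNReal.toReal_mono ENNReal.ofReal_ne_top hlt.le).trans_eq
      (ENNReal.toReal_ofReal (by positivity))
  have split : ∀ κ ∈ couplings μ ν, ∫ z, inner ℝ (ξ z.1) (z.2 - z.1) ∂κ =
      ∫ z, inner ℝ (ξ z.1 - gradient ψ z.1) (z.2 - z.1) ∂κ +
        ∫ z, inner ℝ (gradient ψ z.1) (z.2 - z.1) ∂κ := by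
    intro κ hκ
    rw [← integral_add (integrable_inner_of_memLp (memLp_comp_fst hκ hη) (memLp_displacement hκ))
      (integrable_inner_of_memLp (memLp_comp_fst hκ (memLp_gradient hψ hc μ))
        (memLp_displacement hκ))]
    simp_rw [← inner_add_left, sub_add_cancel]
  have b1 := abs_integral_inner_displacement_le hγ hη
  have b2 := abs_integral_inner_displacement_le hγ' hη
  have b3 := hC μ ν γ hγ
  have b4 := hC μ ν γ' hγ'
  have hs : √(transportCost γ') ≤ √(transportCost γ) := Real.sqrt_le_sqrt hle
  set s := √(transportCost γ) with hsdef
  have hs0 : 0 ≤ s := Real.sqrt_nonneg _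
  have hs2 : transportCost γ = s ^ 2 := (Real.sq_sqrt transportCost_nonneg).symm
  have hCs : C * transportCost γ ≤ ε / 4 * s := by
    have h1 : C * s ≤ ε / 4 := by
      have : C * s ≤ (C + 1) * (ε / (4 * (C + 1))) := by gcongr; linarith
      refine this.trans_eq ?_
      field_simp
    rw [hs2]
    nlinarith
  have hCs' : C * transportCost γ' ≤ ε / 4 * s := (by gcongr : _ ≤ _).trans hCs
  have c1 : (eLpNorm (fun x => ξ x - gradient ψ x) 2 μ.1).toReal * s ≤ ε / 4 * s := by gcongr
  have c2 : (eLpNorm (fun x => ξ x - gradient ψ x) 2 μ.1).toReal * √(transportCost γ') ≤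
      ε / 4 * s := by gcongr
  rw [split γ hγ, split γ' hγ', abs_le]
  rw [abs_le] at b1 b2 b3 b4
  constructor <;> linarith

/-- A Wasserstein gradient is a strong gradient: compare any coupling with an optimal one. -/
theorem IsWassersteinGradient.isStrongGradient {G : P2 p → ℝ} {μ : P2 p} {ξ : 𝔼 → 𝔼}
    (h : IsWassersteinGradient G μ ξ) : IsStrongGradient G μ ξ := by
  obtain ⟨hsub, hsup, htan⟩ := h
  refine ⟨hsub.1, fun ε hε => ?_⟩
  obtain ⟨δ₁, hδ₁, h₁⟩ := hsub.2 (ε / 2) (by positivity)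
  obtain ⟨δ₂, hδ₂, h₂⟩ := hsup.2 (ε / 2) (by positivity)
  obtain ⟨δ₃, hδ₃, h₃⟩ := htan.exists_abs_sub_le (half_pos hε)
  refine ⟨min δ₁ (min δ₂ δ₃), by positivity, fun ν γ hγ hlt => ?_⟩
  obtain ⟨γ', hγ'⟩ := exists_mem_optimalCouplings μ ν
  have hW := W2_le_sqrt_transportCost hγ
  have a1 := h₁ ν (hW.trans_lt (hlt.trans_le (min_le_left _ _))) γ' hγ'
  have a2 := h₂ ν (hW.trans_lt (hlt.trans_le ((min_le_right _ _).trans (min_le_left _ _)))) γ' hγ'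
  have a3 := h₃ ν γ hγ γ' hγ'.1 (hγ'.2 γ hγ)
    (hlt.trans_le ((min_le_right _ _).trans (min_le_right _ _)))
  simp only [inner_neg_left, integral_neg] at a2
  have hW' : ε / 2 * W2 μ ν ≤ ε / 2 * √(transportCost γ) := by gcongr
  rw [abs_le] at a3 ⊢
  constructor <;> linarith

theorem IsStrongGradient.isSubgradient {G : P2 p → ℝ} {μ : P2 p} {ξ : 𝔼 → 𝔼}
    (h : IsStrongGradient G μ ξ) : IsSubgradient G μ ξ := by
  refine ⟨h.1, fun ε hε => ?_⟩
  obtain ⟨δ, hδ, h⟩ := h.2 ε hε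
  refine ⟨δ, hδ, fun ν hν γ hγ => ?_⟩
  rw [W2_eq_of_mem_optimalCouplings hγ] at hν ⊢
  have := (abs_le.1 (h ν γ hγ.1 hν)).1
  linarith

theorem IsStrongGradient.neg {G : P2 p → ℝ} {μ : P2 p} {ξ : 𝔼 → 𝔼}
    (h : IsStrongGradient G μ ξ) : IsStrongGradient (fun ν => -G ν) μ (fun x => -ξ x) := by
  refine ⟨h.1.neg, fun ε hε => ?_⟩
  obtain ⟨δ, hδ, h⟩ := h.2 ε hε
  refine ⟨δ, hδ, fun ν γ hγ hν => ?_⟩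
  simp only [inner_neg_left, integral_neg]
  rw [← abs_neg]
  convert h ν γ hγ hν using 2
  ring

theorem IsStrongGradient.isWassersteinGradient {G : P2 p → ℝ} {μ : P2 p} {ξ : 𝔼 → 𝔼}
    (h : IsStrongGradient G μ ξ) (ht : InTangentSpace μ ξ) : IsWassersteinGradient G μ ξ :=
  ⟨h.isSubgradient, h.neg.isSubgradient, ht⟩

/-- Differentiation along a family of couplings whose cost is quadratic in the parameter. -/
theorem IsStrongGradient.tendsto_div {G : P2 p → ℝ} {μ : P2 p} {ξ : 𝔼 → 𝔼}
    (h : IsStrongGradient G μ ξ) {ν : ℕ → P2 p} {γ : ℕ → Measure (𝔼 × 𝔼)} {t : ℕ → ℝ} {C a : ℝ}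
    (hγ : ∀ n, γ n ∈ couplings μ (ν n)) (ht : ∀ n, 0 < t n) (ht0 : Tendsto t atTop (𝓝 0))
    (hC : ∀ n, √(transportCost (γ n)) ≤ C * t n)
    (ha : Tendsto (fun n => (∫ z, inner ℝ (ξ z.1) (z.2 - z.1) ∂(γ n)) / t n) atTop (𝓝 a)) :
    Tendsto (fun n => (G (ν n) - G μ) / t n) atTop (𝓝 a) := by
  have hC0 : 0 ≤ C := by
    have := (Real.sqrt_nonneg _).trans (hC 0)
    exact nonneg_of_mul_nonneg_left this (ht 0)
  suffices hs : Tendsto (fun n => (G (ν n) - G μ) / t n -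
      (∫ z, inner ℝ (ξ z.1) (z.2 - z.1) ∂(γ n)) / t n) atTop (𝓝 0) by
    simpa using hs.add ha
  rw [Metric.tendsto_nhds]
  intro ε hε
  obtain ⟨δ, hδ, h⟩ := h.2 (ε / (C + 1)) (by positivity)
  have hlim : Tendsto (fun n => C * t n) atTop (𝓝 0) := by simpa using ht0.const_mul C
  filter_upwards [hlim.eventually_lt_const hδ] with n hn
  have := h (ν n) (γ n) (hγ n) ((hC n).trans_lt hn)
  rw [dist_zero_right, Real.norm_eq_abs, ← sub_div, abs_div, abs_of_pos (ht n), div_lt_iff₀ (ht n)]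
  refine this.trans_lt ?_
  calc ε / (C + 1) * √(transportCost (γ n)) ≤ ε / (C + 1) * (C * t n) := by gcongr; exact hC n
    _ < ε / (C + 1) * ((C + 1) * t n) := by
        have := ht n
        gcongr
        linarith
    _ = ε * t n := by field_simp

/-- The coupling of `μ` with its image under the displacement `x ↦ x + t v(x)`. -/
theorem exists_coupling_displacement (μ : P2 p) {v : 𝔼 → 𝔼} {K : NNReal} (hv : LipschitzWith K v)
    (hv2 : MemLp v 2 μ.1) {t : ℝ} (ht : 0 < t) :
    ∃ ν : P2 p, ∃ γ ∈ couplings μ ν,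
      √(transportCost γ) = (eLpNorm v 2 μ.1).toReal * t ∧
      ∀ ξ : 𝔼 → 𝔼, MemLp ξ 2 μ.1 →
        ∫ z, inner ℝ (ξ z.1) (z.2 - z.1) ∂γ = t * ∫ x, inner ℝ (ξ x) (v x) ∂μ.1 := by
  have hvc := hv.continuous
  have hL : LipschitzWith (1 + ‖t‖₊ * K) (fun x => x + t • v x) := by
    refine LipschitzWith.id.add ?_
    exact (lipschitzWith_smul t).comp hv
  have hm : Measurable (fun x => (x, x + t • v x)) := by fun_prop
  refine ⟨μ.map _ hL, μ.1.map (fun x => (x, x + t • v x)), ?_, ?_, ?_⟩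
  · constructor
    · rw [Measure.map_map measurable_fst hm]
      exact Measure.map_id
    · rw [Measure.map_map measurable_snd hm]
      rfl
  · have : transportCost (μ.1.map (fun x => (x, x + t • v x))) =
        ((eLpNorm v 2 μ.1).toReal * t) ^ 2 := by
      rw [transportCost, integral_map hm.aemeasurable (by fun_prop), mul_pow,
        ← integral_norm_sq_eq_eLpNorm_sq hv2, ← integral_mul_const]
      congr 1
      ext x
      simp only [sub_add_cancel_left, norm_neg, norm_smul, Real.norm_eq_abs, mul_pow, sq_abs]
      ring
    rw [this, Real.sqrt_sq (by positivity)]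
  · intro ξ hξ
    rw [integral_map hm.aemeasurable, ← integral_const_mul]
    · simp [inner_smul_right]
    · refine AEStronglyMeasurable.inner ?_ (by fun_prop)
      refine AEStronglyMeasurable.comp_measurable (f := Prod.fst) ?_ measurable_fst
      rw [Measure.map_map measurable_fst hm]
      have e : μ.1.map (Prod.fst ∘ fun x => (x, x + t • v x)) = μ.1 := Measure.map_id
      rw [e]
      exact hξ.1

/-- Strong gradients have the same pairing with every displacement field `v`: both pairings are the
derivative of `G` along the images of `μ` under `x ↦ x + t v(x)`. -/
theorem IsStrongGradient.integral_inner_eq {G : P2 p → ℝ} {μ : P2 p} {ξ ζ : 𝔼 → 𝔼}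
    (hξ : IsStrongGradient G μ ξ) (hζ : IsStrongGradient G μ ζ) {v : 𝔼 → 𝔼} {K : NNReal}
    (hv : LipschitzWith K v) (hv2 : MemLp v 2 μ.1) :
    ∫ x, inner ℝ (ξ x) (v x) ∂μ.1 = ∫ x, inner ℝ (ζ x) (v x) ∂μ.1 := by
  have ht (n : ℕ) : (0 : ℝ) < 1 / (n + 1) := by positivity
  choose ν γ hγ hcost hint using fun n : ℕ => exists_coupling_displacement μ hv hv2 (ht n)
  have key : ∀ η : 𝔼 → 𝔼, IsStrongGradient G μ η →
      Tendsto (fun n : ℕ => (G (ν n) - G μ) / (1 / (n + 1) : ℝ)) atTop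
        (𝓝 (∫ x, inner ℝ (η x) (v x) ∂μ.1)) := by
    intro η hη
    refine hη.tendsto_div hγ ht tendsto_one_div_add_atTop_nhds_zero_nat (fun n => (hcost n).le) ?_
    refine tendsto_const_nhds.congr fun n => ?_
    rw [hint n η hη.1, mul_div_cancel_left₀ _ (ht n).ne']
  exact tendsto_nhds_unique (key ξ hξ) (key ζ hζ)

theorem InTangentSpace.sub {μ : P2 p} {ξ ζ : 𝔼 → 𝔼} (hξ : InTangentSpace μ ξ)
    (hζ : InTangentSpace μ ζ) : InTangentSpace μ (fun x => ξ x - ζ x) := by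
  refine ⟨hξ.1.sub hζ.1, fun ε hε => ?_⟩
  obtain ⟨ψ, hψ, hc, hlt⟩ := hξ.2 (ε / 2) (ENNReal.half_pos hε.ne')
  obtain ⟨χ, hχ, hd, hlt'⟩ := hζ.2 (ε / 2) (ENNReal.half_pos hε.ne')
  refine ⟨fun x => ψ x - χ x, hψ.sub hχ, hc.sub hd, ?_⟩
  have hg (x : 𝔼) : gradient (fun x => ψ x - χ x) x = gradient ψ x - gradient χ x := by
    simp only [gradient]
    rw [fderiv_fun_sub (hψ.differentiable (by norm_cast) x) (hχ.differentiable (by norm_cast) x),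
      map_sub]
  have e : (fun x => ξ x - ζ x - gradient (fun x => ψ x - χ x) x) =
      (fun x => ξ x - gradient ψ x) - fun x => ζ x - gradient χ x := by
    ext1 x
    simp only [hg, Pi.sub_apply]
    abel
  rw [e]
  refine (eLpNorm_sub_le ?_ ?_ one_le_two).trans_lt ?_
  · exact (hξ.1.sub (memLp_gradient hψ hc μ)).1
  · exact (hζ.1.sub (memLp_gradient hχ hd μ)).1
  · calc _ < ε / 2 + ε / 2 := ENNReal.add_lt_add hlt hlt'
      _ = ε := ENNReal.add_halves ε

/-- A tangent field orthogonal to all gradients of test functions vanishes. -/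
theorem InTangentSpace.ae_eq_zero {μ : P2 p} {w : 𝔼 → 𝔼} (hw : InTangentSpace μ w)
    (h : ∀ ψ : 𝔼 → ℝ, ContDiff ℝ (⊤ : ℕ∞) ψ → HasCompactSupport ψ →
      ∫ x, inner ℝ (w x) (gradient ψ x) ∂μ.1 = 0) : w =ᵐ[μ.1] 0 := by
  set N := (eLpNorm w 2 μ.1).toReal with hN
  have hN0 : 0 ≤ N := ENNReal.toReal_nonneg
  have hsmall : ∀ ε > 0, N ^ 2 ≤ N * ε := by
    intro ε hε
    obtain ⟨ψ, hψ, hc, hlt⟩ := hw.2 (ENNReal.ofReal ε) (by simpa using hε)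
    have hg := memLp_gradient hψ hc μ
    have hη : MemLp (fun x => w x - gradient ψ x) 2 μ.1 := hw.1.sub hg
    have e : N ^ 2 = ∫ x, inner ℝ (w x) (w x - gradient ψ x) ∂μ.1 := by
      simp_rw [inner_sub_right]
      rw [integral_sub (integrable_inner_of_memLp hw.1 hw.1) (integrable_inner_of_memLp hw.1 hg),
        h ψ hψ hc, sub_zero, hN, ← integral_norm_sq_eq_eLpNorm_sq hw.1]
      simp_rw [real_inner_self_eq_norm_sq]
    rw [e]
    refine (le_abs_self _).trans ((abs_integral_inner_le hw.1 hη).trans ?_)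
    gcongr
    exact (ENNReal.toReal_mono ENNReal.ofReal_ne_top hlt.le).trans_eq (ENNReal.toReal_ofReal hε.le)
  have hN1 : N = 0 := by
    by_contra hne
    have hpos : 0 < N := lt_of_le_of_ne hN0 (Ne.symm hne)
    have := hsmall (N / 2) (by positivity)
    nlinarith
  rw [← eLpNorm_eq_zero_iff hw.1.1 two_ne_zero]
  exact ((ENNReal.toReal_eq_zero_iff _).1 hN1).resolve_right hw.1.2.ne

/-- Two Wasserstein gradients agree almost everywhere: transporting `μ` along `t ∇ψ` shows that
their difference is orthogonal to every `∇ψ`. -/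
theorem IsWassersteinGradient.ae_eq {G : P2 p → ℝ} {μ : P2 p} {ξ ζ : 𝔼 → 𝔼}
    (hξ : IsWassersteinGradient G μ ξ) (hζ : IsWassersteinGradient G μ ζ) :
    ξ =ᵐ[μ.1] ζ := by
  have := (hξ.2.2.sub hζ.2.2).ae_eq_zero fun ψ hψ hc => by
    have hg := memLp_gradient hψ hc μ
    have h1 : ContDiff ℝ 1 (gradient ψ) :=
      (InnerProductSpace.toDual ℝ 𝔼).symm.contDiff.comp (hψ.fderiv_right (by norm_cast))
    obtain ⟨K, hK⟩ := h1.lipschitzWith_of_hasCompactSupport (hasCompactSupport_gradient hc)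
      one_ne_zero
    simp_rw [inner_sub_left]
    rw [integral_sub (integrable_inner_of_memLp hξ.1.1 hg) (integrable_inner_of_memLp hζ.1.1 hg),
      hξ.isStrongGradient.integral_inner_eq hζ.isStrongGradient hK hg, sub_self]
  filter_upwards [this] with x hx
  exact sub_eq_zero.1 hx

/-! ### The chain rule for strong gradients -/

/-- The points where the first-order expansion of `T` holds with relative error at most `ε` in the
ball of radius `δ`. -/
def uniformExpansionSet {E F : Type*} [NormedAddCommGroup E] [NormedSpace ℝ E]
    [NormedAddCommGroup F] [NormedSpace ℝ F] (T : E → F) (ε δ : ℝ) : Set E :=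
  {x | ∀ h, ‖h‖ < δ → ‖T (x + h) - T x - fderiv ℝ T x h‖ ≤ ε * ‖h‖}

section UniformExpansion

variable {E F : Type*} [NormedAddCommGroup E] [NormedSpace ℝ E] [FiniteDimensional ℝ E]
  [MeasurableSpace E] [BorelSpace E] [NormedAddCommGroup F] [NormedSpace ℝ F]
  [FiniteDimensional ℝ F] [MeasurableSpace F] [BorelSpace F]

/-- By continuity in the increment, a countable dense set of increments suffices. -/
theorem measurableSet_uniformExpansionSet {T : E → F} (hT : Continuous T) (ε δ : ℝ) :
    MeasurableSet (uniformExpansionSet T ε δ) := by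
  have : CompleteSpace F := FiniteDimensional.complete ℝ F
  have : ProperSpace E := FiniteDimensional.proper_real E
  have : ProperSpace F := FiniteDimensional.proper_real F
  obtain ⟨D, hDc, hD⟩ := TopologicalSpace.exists_countable_dense E
  have e : uniformExpansionSet T ε δ =
      ⋂ h ∈ D ∩ Metric.ball 0 δ, {x | ‖T (x + h) - T x - fderiv ℝ T x h‖ ≤ ε * ‖h‖} := by
    ext x
    simp only [uniformExpansionSet, Set.mem_iInter]
    refine ⟨fun H h hh => H h (by simpa using hh.2), fun H h hh => ?_⟩
    have hcl : IsClosed {h : E | ‖T (x + h) - T x - fderiv ℝ T x h‖ ≤ ε * ‖h‖} :=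
      isClosed_le (by fun_prop) (by fun_prop)
    have hsub : closure (Metric.ball 0 δ ∩ D) ⊆
        {h : E | ‖T (x + h) - T x - fderiv ℝ T x h‖ ≤ ε * ‖h‖} :=
      hcl.closure_subset_iff.2 fun h hh => H h ⟨hh.2, hh.1⟩
    exact hsub (hD.open_subset_closure_inter Metric.isOpen_ball (by simpa using hh))
  rw [e]
  refine MeasurableSet.biInter (hDc.mono Set.inter_subset_left) fun h _ => ?_
  exact measurableSet_le (by fun_prop) (by fun_prop)

/-- Almost everywhere differentiability is uniform up to a set of small measure. -/
theorem exists_measure_compl_uniformExpansionSet_le {T : E → F} (hT : Continuous T)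
    {μ : Measure E} [IsFiniteMeasure μ] (hd : ∀ᵐ x ∂μ, DifferentiableAt ℝ T x) {ε : ℝ}
    (hε : 0 < ε) {η : ENNReal} (hη : 0 < η) :
    ∃ δ > 0, μ (uniformExpansionSet T ε δ)ᶜ ≤ η := by
  let s (n : ℕ) := (uniformExpansionSet T ε (1 / (n + 1)))ᶜ
  have hanti : Antitone s := by
    intro m n hmn
    refine Set.compl_subset_compl.2 fun x hx h hh => hx h (hh.trans_le ?_)
    exact Nat.one_div_le_one_div hmn
  have hlim := tendsto_measure_iInter_atTop (μ := μ) (s := s)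
    (fun n => (measurableSet_uniformExpansionSet hT _ _).compl.nullMeasurableSet) hanti
    ⟨0, measure_ne_top _ _⟩
  -- A point in all the exceptional sets is not a point of differentiability.
  have hzero : μ (⋂ n, s n) = 0 := by
    refine measure_mono_null ?_ (ae_iff.1 hd)
    intro x hx hdx
    have h1 := hdx.hasFDerivAt.isLittleO.def hε
    have h2 : ∀ᶠ h in 𝓝 (0 : E), ‖T (x + h) - T x - fderiv ℝ T x h‖ ≤ ε * ‖h‖ := by
      have : Tendsto (fun h => x + h) (𝓝 (0 : E)) (𝓝 x) := by
        have hc : Continuous fun h : E => x + h := by fun_prop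
        simpa using hc.tendsto 0
      filter_upwards [this.eventually h1] with h hh
      simpa using hh
    obtain ⟨r, hr, hball⟩ := Metric.eventually_nhds_iff.1 h2
    obtain ⟨n, hn⟩ := exists_nat_one_div_lt hr
    refine Set.mem_iInter.1 hx n fun h hh => hball ?_
    rw [dist_zero_right]
    exact hh.trans hn
  rw [hzero] at hlim
  obtain ⟨n, hn⟩ := (hlim.eventually_lt_const hη).exists
  exact ⟨1 / (n + 1), by positivity, hn.le⟩

end UniformExpansion

/-- Cauchy–Schwarz for the displacement, weighted by a function of the first variable. -/
theorem integral_mul_norm_displacement_le {μ ν : P2 p} {γ : Measure (𝔼 × 𝔼)}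
    (hγ : γ ∈ couplings μ ν) {u : 𝔼 → ℝ} (hu : MemLp u 2 μ.1) :
    Integrable (fun z : 𝔼 × 𝔼 => u z.1 * ‖z.2 - z.1‖) γ ∧
      ∫ z, u z.1 * ‖z.2 - z.1‖ ∂γ ≤ (eLpNorm u 2 μ.1).toReal * √(transportCost γ) := by
  have hfst := measurePreserving_fst_of_mem_couplings hγ
  have h1 : MemLp (fun z : 𝔼 × 𝔼 => u z.1) 2 γ := hu.comp_measurePreserving hfst
  have h2 : MemLp (fun z : 𝔼 × 𝔼 => ‖z.2 - z.1‖) 2 γ := (memLp_displacement hγ).norm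
  have h3 := abs_integral_inner_le h2 h1
  have h4 := integrable_inner_of_memLp h2 h1
  simp only [RCLike.inner_apply, conj_trivial] at h3 h4
  refine ⟨h4, (le_abs_self _).trans (h3.trans (le_of_eq ?_))⟩
  rw [eLpNorm_norm, sqrt_transportCost hγ, mul_comm]
  congr 2
  exact eLpNorm_comp_measurePreserving hu.1 hfst

section ChainRule

variable {T : EuclideanSpace ℝ (Fin p) → EuclideanSpace ℝ (Fin p)} {K : NNReal}

theorem norm_expansion_remainder_le (hT : LipschitzWith K T) (x y : 𝔼) :
    ‖T y - T x - fderiv ℝ T x (y - x)‖ ≤ 2 * K * ‖y - x‖ := by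
  have h1 := hT.norm_sub_le y x
  have h2 := (fderiv ℝ T x).le_of_opNorm_le (norm_fderiv_le_of_lipschitz ℝ hT) (y - x)
  calc _ ≤ ‖T y - T x‖ + ‖fderiv ℝ T x (y - x)‖ := norm_sub_le _ _
    _ ≤ K * ‖y - x‖ + K * ‖y - x‖ := add_le_add h1 h2
    _ = _ := by ring

theorem measurable_expansion_remainder (hT : LipschitzWith K T) :
    Measurable fun z : 𝔼 × 𝔼 => T z.2 - T z.1 - fderiv ℝ T z.1 (z.2 - z.1) := by
  have hTc := hT.continuous
  have h1 : Measurable fun z : 𝔼 × 𝔼 => fderiv ℝ T z.1 :=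
    (measurable_fderiv ℝ T).comp measurable_fst
  have h2 : Measurable fun z : 𝔼 × 𝔼 => fderiv ℝ T z.1 (z.2 - z.1) := by
    have hc : Continuous fun q : (𝔼 →L[ℝ] 𝔼) × 𝔼 => q.1 q.2 := by fun_prop
    exact hc.measurable.comp (h1.prodMk (by fun_prop))
  fun_prop

theorem memLp_expansion_remainder (hT : LipschitzWith K T) {μ ν : P2 p} {γ : Measure (𝔼 × 𝔼)}
    (hγ : γ ∈ couplings μ ν) :
    MemLp (fun z => T z.2 - T z.1 - fderiv ℝ T z.1 (z.2 - z.1)) 2 γ :=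
  (memLp_displacement hγ).of_le_mul (measurable_expansion_remainder hT).aestronglyMeasurable
    (Eventually.of_forall fun z => norm_expansion_remainder_le hT z.1 z.2)

theorem toReal_eLpNorm_expansion_remainder_le (hT : LipschitzWith K T) {μ ν : P2 p}
    {γ : Measure (𝔼 × 𝔼)} (hγ : γ ∈ couplings μ ν) :
    (eLpNorm (fun z => T z.2 - T z.1 - fderiv ℝ T z.1 (z.2 - z.1)) 2 γ).toReal ≤
      2 * K * √(transportCost γ) := by
  have h := eLpNorm_le_mul_eLpNorm_of_ae_le_mul
    (Eventually.of_forall fun z : 𝔼 × 𝔼 => norm_expansion_remainder_le hT z.1 z.2) (μ := γ) 2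
  rw [sqrt_transportCost hγ]
  refine (ENNReal.toReal_mono ?_ h).trans_eq ?_
  · exact ENNReal.mul_ne_top ENNReal.ofReal_ne_top (memLp_displacement hγ).2.ne
  · rw [ENNReal.toReal_mul, ENNReal.toReal_ofReal (by positivity)]

/-- Tested against an `L²` field, the first-order remainder of a Lipschitz map that is almost
everywhere differentiable is `o(√cost)` uniformly over couplings. Approximating the field by a
bounded one, the remainder is small where the expansion is uniform, and the rest has small
measure or displacement bounded below. -/
theorem exists_abs_integral_inner_remainder_le (hT : LipschitzWith K T) {μ : P2 p}
    (hd : ∀ᵐ x ∂μ.1, DifferentiableAt ℝ T x) {f : 𝔼 → 𝔼} (hf : MemLp f 2 μ.1) {ε : ℝ}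
    (hε : 0 < ε) :
    ∃ δ > 0, ∀ ν : P2 p, ∀ γ ∈ couplings μ ν, √(transportCost γ) < δ →
      |∫ z, inner ℝ (f z.1) (T z.2 - T z.1 - fderiv ℝ T z.1 (z.2 - z.1)) ∂γ| ≤
        ε * √(transportCost γ) := by
  obtain ⟨g, hg, hgm⟩ := hf.exists_boundedContinuous_eLpNorm_sub_le (by simp)
    (ε := ENNReal.ofReal (ε / (8 * (K + 1))))
    (by rw [ne_eq, ENNReal.ofReal_eq_zero, not_le]; positivity)
  set M := ‖g‖ with hM
  have hM0 : 0 ≤ M := norm_nonneg _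
  have hK0 : (0 : ℝ) ≤ K := K.2
  obtain ⟨δ, hδ, hA⟩ := exists_measure_compl_uniformExpansionSet_le hT.continuous hd
    (ε := ε / (4 * (M + 1))) (by positivity)
    (η := ENNReal.ofReal ((ε / (8 * (K + 1) * (M + 1))) ^ 2))
    (by rw [ENNReal.ofReal_pos]; positivity)
  set A := uniformExpansionSet T (ε / (4 * (M + 1))) δ with hAdef
  have hAm : MeasurableSet A := measurableSet_uniformExpansionSet hT.continuous _ _
  refine ⟨ε * δ / (8 * (K + 1) * (M + 1)), by positivity, fun ν γ hγ hlt => ?_⟩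
  have hprob := isProbabilityMeasure_of_mem_couplings hγ
  set s := √(transportCost γ) with hs
  have hs0 : 0 ≤ s := Real.sqrt_nonneg _
  have hs2 : transportCost γ = s ^ 2 := (Real.sq_sqrt transportCost_nonneg).symm
  set r := fun z : 𝔼 × 𝔼 => T z.2 - T z.1 - fderiv ℝ T z.1 (z.2 - z.1) with hr
  have hrL : MemLp r 2 γ := memLp_expansion_remainder hT hγ
  have hfg : MemLp (fun x => f x - g x) 2 μ.1 := hf.sub hgm
  have split : ∫ z, inner ℝ (f z.1) (r z) ∂γ =
      ∫ z, inner ℝ (f z.1 - g z.1) (r z) ∂γ + ∫ z, inner ℝ (g z.1) (r z) ∂γ := by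
    rw [← integral_add (integrable_inner_of_memLp (memLp_comp_fst hγ hfg) hrL)
      (integrable_inner_of_memLp (memLp_comp_fst hγ hgm) hrL)]
    simp_rw [← inner_add_left, sub_add_cancel]
  have b1 : |∫ z, inner ℝ (f z.1 - g z.1) (r z) ∂γ| ≤ ε / 4 * s := by
    refine (abs_integral_inner_le (memLp_comp_fst hγ hfg) hrL).trans ?_
    have e1 : (eLpNorm (fun z : 𝔼 × 𝔼 => f z.1 - g z.1) 2 γ).toReal ≤ ε / (8 * (K + 1)) := by
      rw [eLpNorm_comp_fst hγ hfg]
      exact (ENNReal.toReal_mono ENNReal.ofReal_ne_top hg).trans_eq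
        (ENNReal.toReal_ofReal (by positivity))
    calc _ ≤ ε / (8 * (K + 1)) * (2 * K * s) :=
          mul_le_mul e1 (toReal_eLpNorm_expansion_remainder_le hT hγ) ENNReal.toReal_nonneg
            (by positivity)
      _ ≤ ε / (8 * (K + 1)) * (2 * (K + 1) * s) := by gcongr; linarith
      _ = ε / 4 * s := by field_simp; ring
  -- The three terms of the pointwise bound for the remainder: uniform expansion, exceptional set,
  -- and displacements larger than `δ`, where `‖y - x‖ ≤ ‖y - x‖² / δ`.
  have hu1 := integral_mul_norm_displacement_le hγ
    (memLp_const (μ := μ.1) (p := 2) (ε / (4 * (M + 1))))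
  have hu2 := integral_mul_norm_displacement_le hγ
    (u := Aᶜ.indicator fun _ => (1 : ℝ))
    ((memLp_const (μ := μ.1) (p := 2) (1 : ℝ)).indicator hAm.compl)
  have hpt : ∀ z : 𝔼 × 𝔼, ‖r z‖ ≤ ε / (4 * (M + 1)) * ‖z.2 - z.1‖ +
      (2 * K * (Aᶜ.indicator (fun _ => (1 : ℝ)) z.1 * ‖z.2 - z.1‖) +
        2 * K / δ * ‖z.2 - z.1‖ ^ 2) := by
    intro z
    have h0 := norm_expansion_remainder_le hT z.1 z.2
    by_cases hz : z.1 ∈ A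
    · by_cases hzd : ‖z.2 - z.1‖ < δ
      · have := hz (z.2 - z.1) hzd
        rw [add_sub_cancel] at this
        have h3 : 0 ≤ 2 * (K : ℝ) * (Aᶜ.indicator (fun _ => (1 : ℝ)) z.1 * ‖z.2 - z.1‖) := by
          have : (0 : ℝ) ≤ Aᶜ.indicator (fun _ => (1 : ℝ)) z.1 :=
            Set.indicator_nonneg (fun _ _ => zero_le_one) _
          positivity
        have h4 : 0 ≤ 2 * K / δ * ‖z.2 - z.1‖ ^ 2 := by positivity
        linarith
      · have h3 : 2 * K * ‖z.2 - z.1‖ ≤ 2 * K / δ * ‖z.2 - z.1‖ ^ 2 := by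
          rw [not_lt] at hzd
          have : 2 * K / δ * ‖z.2 - z.1‖ ^ 2 = 2 * K * ‖z.2 - z.1‖ * (‖z.2 - z.1‖ / δ) := by
            ring
          rw [this]
          exact le_mul_of_one_le_right (by positivity) ((one_le_div hδ).2 hzd)
        have h4 : 0 ≤ ε / (4 * (M + 1)) * ‖z.2 - z.1‖ := by positivity
        simp only [Set.indicator_of_notMem (Set.notMem_compl_iff.2 hz), zero_mul, mul_zero]
        linarith
    · rw [Set.indicator_of_mem (Set.mem_compl hz), one_mul]
      have h3 : 0 ≤ 2 * K / δ * ‖z.2 - z.1‖ ^ 2 := by positivity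
      have h4 : 0 ≤ ε / (4 * (M + 1)) * ‖z.2 - z.1‖ := by positivity
      linarith
  have b2 : |∫ z, inner ℝ (g z.1) (r z) ∂γ| ≤ 3 * (ε / 4) * s := by
    rw [← Real.norm_eq_abs]
    have hint : Integrable (fun z : 𝔼 × 𝔼 => M * (ε / (4 * (M + 1)) * ‖z.2 - z.1‖ +
      (2 * K * (Aᶜ.indicator (fun _ => (1 : ℝ)) z.1 * ‖z.2 - z.1‖) +
        2 * K / δ * ‖z.2 - z.1‖ ^ 2))) γ :=
      (hu1.1.add ((hu2.1.const_mul _).add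
        ((integrable_displacement_sq hγ).const_mul _))).const_mul _
    refine (norm_integral_le_of_norm_le hint (Eventually.of_forall fun z => ?_)).trans ?_
    · refine (norm_inner_le_norm _ _).trans ?_
      exact mul_le_mul (g.norm_coe_le_norm _) (hpt z) (norm_nonneg _) hM0
    · have e0 : ∫ z : 𝔼 × 𝔼, ‖z.2 - z.1‖ ^ 2 ∂γ = s ^ 2 := by
        rw [← hs2, transportCost]
        simp_rw [norm_sub_rev]
      have i2 := hu2.1.const_mul (2 * (K : ℝ))
      have i3 := (integrable_displacement_sq hγ).const_mul (2 * (K : ℝ) / δ)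
      have i23 : Integrable (fun z : 𝔼 × 𝔼 => 2 * (K : ℝ) * (Aᶜ.indicator (fun _ => (1 : ℝ)) z.1 *
          ‖z.2 - z.1‖) + 2 * K / δ * ‖z.2 - z.1‖ ^ 2) γ := i2.add i3
      rw [integral_const_mul, integral_add hu1.1 i23, integral_add i2 i3,
        integral_const_mul (2 * (K : ℝ)), integral_const_mul (2 * (K : ℝ) / δ), e0]
      have n1 : (eLpNorm (fun _ : 𝔼 => ε / (4 * (M + 1))) 2 μ.1).toReal = ε / (4 * (M + 1)) := by
        rw [eLpNorm_const _ two_ne_zero (NeZero.ne _), measure_univ, ENNReal.one_rpow, mul_one,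
          toReal_enorm, Real.norm_of_nonneg (by positivity)]
      have n2 : (eLpNorm (Aᶜ.indicator fun _ => (1 : ℝ)) 2 μ.1).toReal ≤
          ε / (8 * (K + 1) * (M + 1)) := by
        rw [eLpNorm_indicator_const hAm.compl two_ne_zero (by simp), enorm_one, one_mul]
        have hle : μ.1 Aᶜ ^ (1 / (2 : ENNReal).toReal) ≤
            ENNReal.ofReal (ε / (8 * (K + 1) * (M + 1))) := by
          calc _ ≤ (ENNReal.ofReal ((ε / (8 * (K + 1) * (M + 1))) ^ 2)) ^
                (1 / (2 : ENNReal).toReal) := by gcongr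
            _ = _ := by
              rw [ENNReal.ofReal_rpow_of_nonneg (by positivity) (by simp), ENNReal.toReal_ofNat,
                ← Real.sqrt_eq_rpow, Real.sqrt_sq (by positivity)]
        exact (ENNReal.toReal_mono ENNReal.ofReal_ne_top hle).trans_eq
          (ENNReal.toReal_ofReal (by positivity))
      have m1 : ∫ z : 𝔼 × 𝔼, ε / (4 * (M + 1)) * ‖z.2 - z.1‖ ∂γ ≤ ε / (4 * (M + 1)) * s :=
        hu1.2.trans_eq (by rw [n1])
      have m2 := hu2.2.trans (mul_le_mul_of_nonneg_right n2 hs0)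
      have m3 : 2 * K / δ * s ^ 2 ≤ 2 * K / δ * (ε * δ / (8 * (K + 1) * (M + 1)) * s) := by
        rw [sq]
        gcongr
      calc _ ≤ M * (ε / (4 * (M + 1)) * s + (2 * K * (ε / (8 * (K + 1) * (M + 1)) * s) +
            2 * K / δ * (ε * δ / (8 * (K + 1) * (M + 1)) * s))) := by gcongr
        _ ≤ (M + 1) * (ε / (4 * (M + 1)) * s + (2 * (K + 1) * (ε / (8 * (K + 1) * (M + 1)) * s) +
            2 * (K + 1) / δ * (ε * δ / (8 * (K + 1) * (M + 1)) * s))) := by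
              gcongr <;> linarith
        _ = 3 * (ε / 4) * s := by field_simp; ring
  rw [split]
  calc _ ≤ _ := abs_add_le _ _
    _ ≤ ε / 4 * s + 3 * (ε / 4) * s := add_le_add b1 b2
    _ = ε * s := by ring

theorem map_prodMap_mem_couplings (hT : LipschitzWith K T) {μ ν : P2 p} {γ : Measure (𝔼 × 𝔼)}
    (hγ : γ ∈ couplings μ ν) : γ.map (Prod.map T T) ∈ couplings (μ.map T hT) (ν.map T hT) := by
  have hTm : Measurable T := hT.continuous.measurable
  have h1 : (γ.map Prod.fst).map T = μ.1.map T := by rw [hγ.1]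
  have h2 : (γ.map Prod.snd).map T = ν.1.map T := by rw [hγ.2]
  rw [Measure.map_map hTm measurable_fst] at h1
  rw [Measure.map_map hTm measurable_snd] at h2
  constructor
  · rw [Measure.map_map measurable_fst (hTm.prodMap hTm)]
    exact h1
  · rw [Measure.map_map measurable_snd (hTm.prodMap hTm)]
    exact h2

theorem sqrt_transportCost_map_le (hT : LipschitzWith K T) {μ ν : P2 p} {γ : Measure (𝔼 × 𝔼)}
    (hγ : γ ∈ couplings μ ν) :
    √(transportCost (γ.map (Prod.map T T))) ≤ K * √(transportCost γ) := by
  have hTc := hT.continuous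
  have hTm : Measurable T := hTc.measurable
  rw [transportCost, integral_map (hTm.prodMap hTm).aemeasurable (by fun_prop),
    Real.sqrt_le_left (by positivity), mul_pow, Real.sq_sqrt transportCost_nonneg, transportCost,
    ← integral_const_mul]
  have hi : Integrable (fun z : 𝔼 × 𝔼 => ‖z.1 - z.2‖ ^ 2) γ := by
    simpa only [norm_sub_rev] using integrable_displacement_sq hγ
  refine integral_mono_of_nonneg (Eventually.of_forall fun _ => sq_nonneg _) (hi.const_mul _)
    (Eventually.of_forall fun z => ?_)
  have := hT.norm_sub_le z.1 z.2
  simp only [Prod.map_fst, Prod.map_snd]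
  rw [← mul_pow]
  gcongr

theorem measurePreserving_map (hT : LipschitzWith K T) (μ : P2 p) :
    MeasurePreserving T μ.1 (μ.map T hT).1 := ⟨hT.continuous.measurable, rfl⟩

theorem aestronglyMeasurable_adjoint_fderiv_apply {μ : Measure 𝔼} {f : 𝔼 → 𝔼}
    (hf : AEStronglyMeasurable f μ) :
    AEStronglyMeasurable (fun x => ContinuousLinearMap.adjoint (fderiv ℝ T x) (f x)) μ := by
  have h1 : Measurable fun x => ContinuousLinearMap.adjoint (fderiv ℝ T x) :=
    (ContinuousLinearMap.adjoint (𝕜 := ℝ) (E := 𝔼) (F := 𝔼)).continuous.measurable.comp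
      (measurable_fderiv ℝ T)
  have hc : Continuous fun q : (𝔼 →L[ℝ] 𝔼) × 𝔼 => q.1 q.2 := by fun_prop
  exact hc.comp_aestronglyMeasurable (h1.aestronglyMeasurable.prodMk hf)

theorem norm_adjoint_fderiv_apply_le (hT : LipschitzWith K T) (x v : 𝔼) :
    ‖ContinuousLinearMap.adjoint (fderiv ℝ T x) v‖ ≤ K * ‖v‖ :=
  ContinuousLinearMap.le_of_opNorm_le _
    ((LinearIsometryEquiv.norm_map _ _).trans_le (norm_fderiv_le_of_lipschitz ℝ hT)) v

theorem memLp_adjoint_fderiv_apply (hT : LipschitzWith K T) {μ : Measure 𝔼} {f : 𝔼 → 𝔼}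
    (hf : MemLp f 2 μ) :
    MemLp (fun x => ContinuousLinearMap.adjoint (fderiv ℝ T x) (f x)) 2 μ :=
  hf.of_le_mul (aestronglyMeasurable_adjoint_fderiv_apply hf.1)
    (Eventually.of_forall fun x => norm_adjoint_fderiv_apply_le hT x (f x))

/-- The chain rule for strong gradients: push a coupling forward under `T × T`, and replace
`T(y) - T(x)` by its first-order expansion. -/
theorem IsStrongGradient.comp_map (hT : LipschitzWith K T) {μ : P2 p}
    (hd : ∀ᵐ x ∂μ.1, DifferentiableAt ℝ T x) {F : P2 p → ℝ} {ξ : 𝔼 → 𝔼}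
    (h : IsStrongGradient F (μ.map T hT) ξ) :
    IsStrongGradient (fun ν => F (ν.map T hT)) μ
      (fun x => ContinuousLinearMap.adjoint (fderiv ℝ T x) (ξ (T x))) := by
  have hTm : Measurable T := hT.continuous.measurable
  have hξT : MemLp (fun x => ξ (T x)) 2 μ.1 :=
    h.1.comp_measurePreserving (measurePreserving_map hT μ)
  have hL := memLp_adjoint_fderiv_apply hT hξT
  refine ⟨hL, fun ε hε => ?_⟩
  have hK0 : (0 : ℝ) ≤ K := K.2
  obtain ⟨δ₁, hδ₁, h₁⟩ := h.2 (ε / (2 * (K + 1))) (by positivity)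
  obtain ⟨δ₂, hδ₂, h₂⟩ := exists_abs_integral_inner_remainder_le hT hd hξT (half_pos hε)
  refine ⟨min (δ₁ / (K + 1)) δ₂, by positivity, fun ν γ hγ hlt => ?_⟩
  have hγ' := map_prodMap_mem_couplings hT hγ
  have hcost := sqrt_transportCost_map_le hT hγ
  set s := √(transportCost γ) with hs
  have hs0 : 0 ≤ s := Real.sqrt_nonneg _
  have hs1 : K * s ≤ (K + 1) * s := by gcongr; linarith
  have a1 := h₁ (ν.map T hT) _ hγ' (by
    refine hcost.trans_lt (hs1.trans_lt ?_)
    rw [← lt_div_iff₀' (by positivity)]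
    exact hlt.trans_le (min_le_left _ _))
  have a2 := h₂ ν γ hγ (hlt.trans_le (min_le_right _ _))
  have e : ∫ z, inner ℝ (ξ z.1) (z.2 - z.1) ∂(γ.map (Prod.map T T)) =
      ∫ z, inner ℝ (ContinuousLinearMap.adjoint (fderiv ℝ T z.1) (ξ (T z.1))) (z.2 - z.1) ∂γ +
        ∫ z, inner ℝ (ξ (T z.1)) (T z.2 - T z.1 - fderiv ℝ T z.1 (z.2 - z.1)) ∂γ := by
    rw [integral_map (hTm.prodMap hTm).aemeasurable
      (integrable_inner_of_memLp (memLp_comp_fst hγ' h.1) (memLp_displacement hγ')).1,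
      ← integral_add (integrable_inner_of_memLp (memLp_comp_fst hγ hL) (memLp_displacement hγ))
        (integrable_inner_of_memLp (memLp_comp_fst hγ hξT) (memLp_expansion_remainder hT hγ))]
    simp only [ContinuousLinearMap.adjoint_inner_left, ← inner_add_right, add_sub_cancel,
      Prod.map_fst, Prod.map_snd]
  rw [e] at a1
  have a3 : ε / (2 * (K + 1)) * √(transportCost (γ.map (Prod.map T T))) ≤ ε / 2 * s := by
    calc _ ≤ ε / (2 * (K + 1)) * ((K + 1) * s) := by gcongr; exact hcost.trans hs1
      _ = ε / 2 * s := by field_simp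
  rw [abs_le] at a1 a2 ⊢
  constructor <;> linarith

end ChainRule

/-! ### Mollification and the tangent space -/

/-- The smooth bump function at the origin equal to `1` on the ball of radius `r` and supported in
the ball of radius `2 r`. For varying `r` these are rescalings of each other. -/
noncomputable def dyadicBump (r : ℝ) (hr : 0 < r) :
    ContDiffBump (0 : EuclideanSpace ℝ (Fin p)) :=
  ⟨r, 2 * r, hr, by linarith⟩

theorem dyadicBump_eq_comp_smul {r : ℝ} (hr : 0 < r) :
    (dyadicBump r hr : 𝔼 → ℝ) = fun x => dyadicBump 1 one_pos (r⁻¹ • x) := by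
  ext x
  rw [ContDiffBump.apply, ContDiffBump.apply]
  simp [dyadicBump, hr.ne']

theorem exists_norm_fderiv_dyadicBump_le :
    ∃ C : ℝ, 0 < C ∧ ∀ (r : ℝ) (hr : 0 < r) (x : 𝔼),
      ‖fderiv ℝ (dyadicBump r hr : 𝔼 → ℝ) x‖ ≤ C / r := by
  have hs : ContDiff ℝ 1 (dyadicBump 1 one_pos : ContDiffBump (0 : 𝔼)) := ContDiffBump.contDiff _
  have hc : HasCompactSupport (dyadicBump 1 one_pos : ContDiffBump (0 : 𝔼)) :=
    ContDiffBump.hasCompactSupport _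
  have hcont := hs.continuous_fderiv one_ne_zero
  obtain ⟨C, hC⟩ := (hc.fderiv ℝ).exists_bound_of_continuous hcont
  refine ⟨|C| + 1, by positivity, fun r hr x => ?_⟩
  rw [dyadicBump_eq_comp_smul hr, fderiv_comp_smul, norm_smul, norm_inv, Real.norm_of_nonneg hr.le,
    div_eq_inv_mul]
  gcongr
  exact (hC _).trans (by linarith [le_abs_self C])

theorem fderiv_normed_dyadicBump {r : ℝ} (hr : 0 < r) (x : 𝔼) :
    fderiv ℝ ((dyadicBump r hr : ContDiffBump (0 : 𝔼)).normed volume) x =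
      (∫ y : 𝔼, dyadicBump r hr y)⁻¹ • fderiv ℝ (dyadicBump r hr : 𝔼 → ℝ) x := by
  have hd : DifferentiableAt ℝ (dyadicBump r hr : 𝔼 → ℝ) x :=
    (ContDiffBump.contDiff (n := 1) _).differentiable one_ne_zero x
  rw [← fderiv_const_smul hd]
  congr 1
  ext y
  rw [ContDiffBump.normed_def, Pi.smul_apply, smul_eq_mul, div_eq_inv_mul]

theorem fderiv_normed_dyadicBump_eq_zero {r : ℝ} (hr : 0 < r) {x : 𝔼} (hx : 2 * r < ‖x‖) :
    fderiv ℝ ((dyadicBump r hr : ContDiffBump (0 : 𝔼)).normed volume) x = 0 := by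
  refine image_eq_zero_of_notMem_tsupport fun h => ?_
  have := tsupport_fderiv_subset ℝ h
  rw [ContDiffBump.tsupport_normed_eq, Metric.mem_closedBall, dist_zero_right] at this
  exact absurd this (not_le.2 hx)

theorem continuous_fderiv_normed_dyadicBump {r : ℝ} (hr : 0 < r) :
    Continuous (fderiv ℝ ((dyadicBump r hr : ContDiffBump (0 : 𝔼)).normed volume)) :=
  (ContDiffBump.contDiff_normed (n := 1) _).continuous_fderiv one_ne_zero

theorem integrable_norm_fderiv_normed_dyadicBump {r : ℝ} (hr : 0 < r) :
    Integrable fun x => ‖fderiv ℝ ((dyadicBump r hr : ContDiffBump (0 : 𝔼)).normed volume) x‖ :=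
  ((continuous_fderiv_normed_dyadicBump hr).integrable_of_hasCompactSupport
    ((ContDiffBump.hasCompactSupport_normed _).fderiv ℝ)).norm

/-- The gradient of the mollifier of radius `r` has `L¹` norm of order `1 / r`. -/
theorem exists_integral_norm_fderiv_normed_le :
    ∃ C : ℝ, 0 < C ∧ ∀ (r : ℝ) (hr : 0 < r),
      ∫ x, ‖fderiv ℝ ((dyadicBump r hr : ContDiffBump (0 : 𝔼)).normed volume) x‖ ≤ C / r := by
  obtain ⟨C, hC0, hC⟩ := exists_norm_fderiv_dyadicBump_le (p := p)
  refine ⟨C * 2 ^ Module.finrank ℝ 𝔼, by positivity, fun r hr => ?_⟩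
  set φ : ContDiffBump (0 : 𝔼) := dyadicBump r hr with hφ
  set V := volume.real (Metric.closedBall (0 : 𝔼) (2 * r)) with hV
  have hI : V / 2 ^ Module.finrank ℝ 𝔼 ≤ ∫ y, φ y :=
    φ.measure_closedBall_div_le_integral (μ := volume) 2 le_rfl
  have hV0 : 0 < V := by
    rw [hV, measureReal_def, ENNReal.toReal_pos_iff]
    exact ⟨Metric.measure_closedBall_pos _ _ (by positivity), measure_closedBall_lt_top⟩
  have hpt : ∀ x, ‖fderiv ℝ (φ.normed volume) x‖ ≤
      (Metric.closedBall (0 : 𝔼) (2 * r)).indicator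
        (fun _ => (V / 2 ^ Module.finrank ℝ 𝔼)⁻¹ * (C / r)) x := by
    intro x
    by_cases hx : x ∈ Metric.closedBall (0 : 𝔼) (2 * r)
    · rw [Set.indicator_of_mem hx, fderiv_normed_dyadicBump, norm_smul, norm_inv,
        Real.norm_of_nonneg (ContDiffBump.integral_pos _).le]
      gcongr
      exact hC r hr x
    · rw [Set.indicator_of_notMem hx, fderiv_normed_dyadicBump_eq_zero hr, norm_zero]
      simpa using hx
  calc _ ≤ ∫ x, (Metric.closedBall (0 : 𝔼) (2 * r)).indicator
        (fun _ => (V / 2 ^ Module.finrank ℝ 𝔼)⁻¹ * (C / r)) x := by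
        refine integral_mono (integrable_norm_fderiv_normed_dyadicBump hr) ?_ hpt
        rw [integrable_indicator_iff measurableSet_closedBall]
        exact integrableOn_const measure_closedBall_lt_top.ne
    _ = V * ((V / 2 ^ Module.finrank ℝ 𝔼)⁻¹ * (C / r)) := by
        rw [integral_indicator_const _ measurableSet_closedBall, smul_eq_mul]
    _ = _ := by field_simp

/-- A standard sequence of mollifiers: the `n`-th has integral one and is supported in the ball of
radius `2 / (n + 1)`. -/
noncomputable def mollifier (n : ℕ) : EuclideanSpace ℝ (Fin p) → ℝ :=
  (dyadicBump (1 / (n + 1 : ℝ)) (by positivity) :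
    ContDiffBump (0 : EuclideanSpace ℝ (Fin p))).normed volume

theorem mollifier_contDiff (n : ℕ) {k : ℕ∞} : ContDiff ℝ k (mollifier n : 𝔼 → ℝ) :=
  ContDiffBump.contDiff_normed _

theorem mollifier_hasCompactSupport (n : ℕ) : HasCompactSupport (mollifier n : 𝔼 → ℝ) :=
  ContDiffBump.hasCompactSupport_normed _

theorem mollifier_nonneg (n : ℕ) (x : 𝔼) : 0 ≤ mollifier n x := ContDiffBump.nonneg_normed _ x

theorem integral_mollifier (n : ℕ) : ∫ x : 𝔼, mollifier n x = 1 := ContDiffBump.integral_normed _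

theorem integral_mollifier_sub (n : ℕ) (x : 𝔼) : ∫ y : 𝔼, mollifier n (x - y) = 1 := by
  rw [integral_sub_left_eq_self (mollifier n : 𝔼 → ℝ), integral_mollifier]

theorem integrable_mollifier_sub (n : ℕ) (x : 𝔼) : Integrable fun y : 𝔼 => mollifier n (x - y) :=
  ((mollifier_contDiff n (k := 0)).continuous.integrable_of_hasCompactSupport
    (mollifier_hasCompactSupport n)).comp_sub_left x

theorem hasCompactSupport_comp_sub_left {F : Type*} [Zero F] {f : 𝔼 → F} (hf : HasCompactSupport f)
    (x : 𝔼) : HasCompactSupport fun y => f (x - y) :=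
  hf.comp_homeomorph (Homeomorph.subLeft x)

theorem fderiv_comp_sub_left (f : 𝔼 → ℝ) (hf : Differentiable ℝ f) (x y v : 𝔼) :
    fderiv ℝ (fun y => f (x - y)) y v = - fderiv ℝ f (x - y) v := by
  have h : HasFDerivAt (fun y => x - y) (-ContinuousLinearMap.id ℝ 𝔼) y := by
    simpa using (hasFDerivAt_id y).const_sub x
  have := ((hf (x - y)).hasFDerivAt.comp y h).fderiv
  simp only [Function.comp_def] at this
  rw [this]
  simp

/-- Mollification differentiates affine functions exactly. -/
theorem integral_affine_mul_fderiv_mollifier (n : ℕ) (L : 𝔼 →L[ℝ] ℝ) (c : ℝ) (x v : 𝔼) :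
    ∫ y, (c + L (y - x)) * fderiv ℝ (mollifier n : 𝔼 → ℝ) (x - y) v = L v := by
  have hk := mollifier_contDiff (p := p) n (k := 1)
  have hkd : Differentiable ℝ (mollifier n : 𝔼 → ℝ) := hk.differentiable one_ne_zero
  have hkc := mollifier_hasCompactSupport (p := p) n
  have hk' := hk.continuous_fderiv one_ne_zero
  have hc1 : HasCompactSupport fun y : 𝔼 => mollifier n (x - y) :=
    hasCompactSupport_comp_sub_left hkc x
  have hc2 : HasCompactSupport fun y : 𝔼 => fderiv ℝ (mollifier n : 𝔼 → ℝ) (x - y) v :=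
    (hasCompactSupport_comp_sub_left (hkc.fderiv ℝ) x).comp_left
      (g := fun A : 𝔼 →L[ℝ] ℝ => A v) rfl
  have hkcont := hk.continuous
  have e : ∀ y, fderiv ℝ (fun y => mollifier n (x - y)) y v =
      -fderiv ℝ (mollifier n : 𝔼 → ℝ) (x - y) v := fun y => fderiv_comp_sub_left _ hkd x y v
  have eL : ∀ y, fderiv ℝ (fun y => c + L (y - x)) y v = L v := by
    intro y
    have h : HasFDerivAt (fun y => c + L (y - x)) L y := by
      simpa using (L.hasFDerivAt.comp y ((hasFDerivAt_id y).sub_const x)).const_add c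
    rw [h.fderiv]
  have ibp := integral_mul_fderiv_eq_neg_fderiv_mul_of_integrable (μ := (volume : Measure 𝔼))
    (f := fun y => c + L (y - x)) (g := fun y => mollifier n (x - y)) (v := v) ?_ ?_ ?_
    (fun y _ => by fun_prop) (fun y _ => by fun_prop)
  · simp_rw [e, eL, mul_neg, integral_neg, neg_inj] at ibp
    rw [ibp, integral_const_mul, integral_mollifier_sub, mul_one]
  · simp_rw [eL]
    exact (integrable_mollifier_sub n x).const_mul _
  · simp_rw [e]
    refine Continuous.integrable_of_hasCompactSupport (by fun_prop) ?_
    exact hc2.neg.mul_left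
  · refine Continuous.integrable_of_hasCompactSupport (by fun_prop) ?_
    exact hc1.mul_left

/-- At a point of differentiability, the derivative of the mollification converges to the
derivative. Only the first-order expansion at the point is used, so that the function may be
irregular elsewhere. -/
theorem eventually_abs_integral_mul_fderiv_mollifier_sub_le {g : 𝔼 → ℝ} {x : 𝔼}
    (hg : DifferentiableAt ℝ g x) {ε : ℝ} (hε : 0 < ε)
    (hi : ∀ᶠ n in atTop, ∀ v,
      Integrable fun y => g y * fderiv ℝ (mollifier n : 𝔼 → ℝ) (x - y) v) :
    ∀ᶠ n in atTop, ∀ v,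
      |(∫ y, g y * fderiv ℝ (mollifier n : 𝔼 → ℝ) (x - y) v) - fderiv ℝ g x v| ≤ ε * ‖v‖ := by
  obtain ⟨C, hC0, hC⟩ := exists_integral_norm_fderiv_normed_le (p := p)
  obtain ⟨ρ, hρ, hball⟩ := Metric.eventually_nhds_iff.1
    (hg.hasFDerivAt.isLittleO.def (c := ε / (2 * C)) (by positivity))
  have hlim : Tendsto (fun n : ℕ => 2 * (1 / (n + 1 : ℝ))) atTop (𝓝 0) := by
    simpa using tendsto_one_div_add_atTop_nhds_zero_nat.const_mul (2 : ℝ)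
  filter_upwards [hi, hlim.eventually_lt_const hρ] with n hin hn v
  set r : ℝ := 1 / (n + 1 : ℝ) with hr
  have hr0 : 0 < r := by positivity
  have hk' := (mollifier_contDiff (p := p) n (k := 1)).continuous_fderiv one_ne_zero
  have hkc := mollifier_hasCompactSupport (p := p) n
  have ha : Integrable fun y =>
      (g x + fderiv ℝ g x (y - x)) * fderiv ℝ (mollifier n : 𝔼 → ℝ) (x - y) v := by
    refine Continuous.integrable_of_hasCompactSupport (by fun_prop) ?_
    exact ((hasCompactSupport_comp_sub_left (hkc.fderiv ℝ) x).comp_left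
      (g := fun A : 𝔼 →L[ℝ] ℝ => A v) rfl).mul_left
  rw [← integral_affine_mul_fderiv_mollifier n (fderiv ℝ g x) (g x) x v,
    ← integral_sub (hin v) ha, ← Real.norm_eq_abs]
  have hnorm : Integrable fun y => ‖fderiv ℝ (mollifier n : 𝔼 → ℝ) (x - y)‖ :=
    (integrable_norm_fderiv_normed_dyadicBump (p := p) hr0).comp_sub_left x
  have hpt : ∀ y, ‖g y * fderiv ℝ (mollifier n : 𝔼 → ℝ) (x - y) v -
      (g x + fderiv ℝ g x (y - x)) * fderiv ℝ (mollifier n : 𝔼 → ℝ) (x - y) v‖ ≤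
        ε / (2 * C) * (2 * r) * ‖v‖ * ‖fderiv ℝ (mollifier n : 𝔼 → ℝ) (x - y)‖ := by
    intro y
    rw [← sub_mul, norm_mul]
    by_cases hy : 2 * r < ‖x - y‖
    · have h0 : fderiv ℝ (mollifier n : 𝔼 → ℝ) (x - y) = 0 :=
        fderiv_normed_dyadicBump_eq_zero hr0 hy
      simp [h0]
    · rw [not_lt] at hy
      have h1 := hball (y := y) (by rw [dist_comm, dist_eq_norm]; exact hy.trans_lt hn)
      rw [sub_sub] at h1
      calc _ ≤ ε / (2 * C) * ‖y - x‖ * (‖fderiv ℝ (mollifier n : 𝔼 → ℝ) (x - y)‖ * ‖v‖) :=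
            mul_le_mul h1 (ContinuousLinearMap.le_opNorm _ _) (norm_nonneg _) (by positivity)
        _ ≤ ε / (2 * C) * (2 * r) * (‖fderiv ℝ (mollifier n : 𝔼 → ℝ) (x - y)‖ * ‖v‖) := by
            gcongr
            rwa [norm_sub_rev]
        _ = _ := by ring
  refine (norm_integral_le_of_norm_le (hnorm.const_mul _) (Eventually.of_forall hpt)).trans ?_
  rw [integral_const_mul, integral_sub_left_eq_self
    (fun z => ‖fderiv ℝ (mollifier n : 𝔼 → ℝ) z‖)]
  calc _ ≤ ε / (2 * C) * (2 * r) * ‖v‖ * (C / r) := by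
        gcongr
        exact hC r hr0
    _ = ε * ‖v‖ := by field_simp

/-- The convolution of `g` with the `n`-th mollifier. -/
noncomputable def mollify (g : EuclideanSpace ℝ (Fin p) → ℝ) (n : ℕ) :
    EuclideanSpace ℝ (Fin p) → ℝ :=
  convolution g (mollifier n) (ContinuousLinearMap.mul ℝ ℝ) volume

theorem contDiff_mollify {g : 𝔼 → ℝ} (hg : Continuous g) (n : ℕ) {k : ℕ∞} :
    ContDiff ℝ k (mollify g n) :=
  (mollifier_hasCompactSupport n).contDiff_convolution_right _ hg.locallyIntegrable
    (mollifier_contDiff n)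

theorem fderiv_mollify {g : 𝔼 → ℝ} (hg : Continuous g) (n : ℕ) (x v : 𝔼) :
    fderiv ℝ (mollify g n) x v = ∫ y, g y * fderiv ℝ (mollifier n : 𝔼 → ℝ) (x - y) v := by
  have hk := mollifier_contDiff (p := p) n (k := 1)
  have hkc := mollifier_hasCompactSupport (p := p) n
  rw [mollify, (hkc.hasFDerivAt_convolution_right _ hg.locallyIntegrable hk x).fderiv,
    convolution_precompR_apply _ hg.locallyIntegrable (hkc.fderiv ℝ)
      (hk.continuous_fderiv one_ne_zero)]
  rfl

theorem mollify_eq_integral (g : 𝔼 → ℝ) (n : ℕ) (x : 𝔼) :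
    mollify g n x = ∫ t, g (x - t) * mollifier n t := by
  rw [mollify, convolution_eq_swap]
  rfl

theorem integrable_mollify_integrand {g : 𝔼 → ℝ} (hg : Continuous g) (n : ℕ) (x : 𝔼) :
    Integrable fun t : 𝔼 => g (x - t) * mollifier n t := by
  have := (mollifier_contDiff (p := p) n (k := 0)).continuous
  exact Continuous.integrable_of_hasCompactSupport (by fun_prop)
    (mollifier_hasCompactSupport n).mul_left

theorem norm_mollify_le {g : 𝔼 → ℝ} {B : ℝ} (hB : ∀ x, ‖g x‖ ≤ B) (n : ℕ) (x : 𝔼) :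
    ‖mollify g n x‖ ≤ B := by
  have hi : Integrable (mollifier n : 𝔼 → ℝ) :=
    (mollifier_contDiff n (k := 0)).continuous.integrable_of_hasCompactSupport
      (mollifier_hasCompactSupport n)
  rw [mollify_eq_integral]
  refine (norm_integral_le_of_norm_le (hi.const_mul B) (Eventually.of_forall fun t => ?_)).trans_eq
    ?_
  · rw [norm_mul, Real.norm_of_nonneg (mollifier_nonneg n t)]
    exact mul_le_mul_of_nonneg_right (hB _) (mollifier_nonneg n t)
  · rw [integral_const_mul, integral_mollifier, mul_one]

theorem lipschitzWith_mollify {g : 𝔼 → ℝ} {K : NNReal} (hg : LipschitzWith K g) (n : ℕ) :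
    LipschitzWith K (mollify g n) := by
  have hi : Integrable (mollifier n : 𝔼 → ℝ) :=
    (mollifier_contDiff n (k := 0)).continuous.integrable_of_hasCompactSupport
      (mollifier_hasCompactSupport n)
  refine LipschitzWith.of_dist_le_mul fun x y => ?_
  rw [dist_eq_norm, mollify_eq_integral, mollify_eq_integral,
    ← integral_sub (integrable_mollify_integrand hg.continuous n x)
      (integrable_mollify_integrand hg.continuous n y)]
  refine (norm_integral_le_of_norm_le (hi.const_mul (K * dist x y))
    (Eventually.of_forall fun t => ?_)).trans_eq ?_
  · rw [← sub_mul, norm_mul, Real.norm_of_nonneg (mollifier_nonneg n t)]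
    refine mul_le_mul_of_nonneg_right ?_ (mollifier_nonneg n t)
    simpa [dist_eq_norm] using hg.dist_le_mul (x - t) (y - t)
  · rw [integral_const_mul, integral_mollifier, mul_one]

theorem tendsto_fderiv_mollify {g : 𝔼 → ℝ} (hg : Continuous g) {x : 𝔼}
    (hx : DifferentiableAt ℝ g x) :
    Tendsto (fun n => fderiv ℝ (mollify g n) x) atTop (𝓝 (fderiv ℝ g x)) := by
  rw [Metric.tendsto_nhds]
  intro ε hε
  filter_upwards [eventually_abs_integral_mul_fderiv_mollifier_sub_le hx (half_pos hε)
    (Eventually.of_forall fun n v => by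
      have hk' := (mollifier_contDiff (p := p) n (k := 1)).continuous_fderiv one_ne_zero
      have hkc := mollifier_hasCompactSupport (p := p) n
      refine Continuous.integrable_of_hasCompactSupport (by fun_prop) ?_
      exact ((hasCompactSupport_comp_sub_left (hkc.fderiv ℝ) x).comp_left
        (g := fun A : 𝔼 →L[ℝ] ℝ => A v) rfl).mul_left)] with n hn
  rw [dist_eq_norm]
  refine (ContinuousLinearMap.opNorm_le_bound _ (half_pos hε).le fun v => ?_).trans_lt
    (half_lt_self hε)
  rw [sub_apply, fderiv_mollify hg, Real.norm_eq_abs]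
  exact hn v

/-- Bounded convergence in `L²` of a finite measure. -/
theorem exists_eLpNorm_sub_lt_of_tendsto_of_bounded {μ : Measure 𝔼} [IsFiniteMeasure μ]
    {f : ℕ → 𝔼 → 𝔼} {g : 𝔼 → 𝔼} {C : ℝ} (hf : ∀ n, AEStronglyMeasurable (f n) μ)
    (hC : ∀ n x, ‖f n x‖ ≤ C) (hlim : ∀ᵐ x ∂μ, Tendsto (fun n => f n x) atTop (𝓝 (g x))) :
    MemLp g 2 μ ∧ ∀ ε : ENNReal, 0 < ε → ∃ n, eLpNorm (fun x => g x - f n x) 2 μ < ε := by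
  have hgm : AEStronglyMeasurable g μ := aestronglyMeasurable_of_tendsto_ae atTop hf hlim
  have hgC : ∀ᵐ x ∂μ, ‖g x‖ ≤ C := by
    filter_upwards [hlim] with x hx
    exact le_of_tendsto hx.norm (Eventually.of_forall fun n => hC n x)
  have hg : MemLp g 2 μ := MemLp.of_bound hgm C hgC
  refine ⟨hg, fun ε hε => ?_⟩
  have hd (n : ℕ) : MemLp (fun x => g x - f n x) 2 μ :=
    hg.sub (MemLp.of_bound (hf n) C (Eventually.of_forall (hC n)))
  have h1 : Tendsto (fun n => ∫ x, ‖g x - f n x‖ ^ 2 ∂μ) atTop (𝓝 (∫ _, (0 : ℝ) ∂μ)) := by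
    refine tendsto_integral_of_dominated_convergence (fun _ => (2 * C) ^ 2)
      (fun n => ((hd n).1.norm.pow 2)) (integrable_const _) (fun n => ?_) ?_
    · filter_upwards [hgC] with x hx
      rw [norm_pow, norm_norm]
      have : ‖g x - f n x‖ ≤ 2 * C := (norm_sub_le _ _).trans (by linarith [hC n x])
      gcongr
    · filter_upwards [hlim] with x hx
      have : Tendsto (fun n => ‖g x - f n x‖ ^ 2) atTop (𝓝 (‖g x - g x‖ ^ 2)) :=
        ((tendsto_const_nhds.sub hx).norm.pow 2)
      simpa using this
  simp_rw [integral_norm_sq_eq_eLpNorm_sq (hd _), integral_zero] at h1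
  by_cases htop : ε = ⊤
  · exact ⟨0, htop ▸ (hd 0).2⟩
  have hε' : 0 < ε.toReal := ENNReal.toReal_pos hε.ne' htop
  obtain ⟨n, hn⟩ := (h1.eventually_lt_const (pow_pos hε' 2)).exists
  refine ⟨n, ?_⟩
  rw [← ENNReal.toReal_lt_toReal (hd n).2.ne htop]
  exact lt_of_pow_lt_pow_left₀ 2 hε'.le hn

theorem norm_gradient (g : 𝔼 → ℝ) (x : 𝔼) : ‖gradient g x‖ = ‖fderiv ℝ g x‖ := by
  simp [gradient]

/-- The gradient of a bounded Lipschitz function which is differentiable almost everywhere is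
tangent: mollify and cut off. -/
theorem inTangentSpace_gradient_of_lipschitzWith {μ : P2 p} {g : 𝔼 → ℝ} {K : NNReal}
    (hg : LipschitzWith K g) {B : ℝ} (hB : ∀ x, ‖g x‖ ≤ B)
    (hd : ∀ᵐ x ∂μ.1, DifferentiableAt ℝ g x) : InTangentSpace μ (gradient g) := by
  obtain ⟨C, hC0, hC⟩ := exists_norm_fderiv_dyadicBump_le (p := p)
  have hB0 : 0 ≤ B := (norm_nonneg _).trans (hB 0)
  have hpos (n : ℕ) : (0 : ℝ) < n + 1 := by positivity
  let χ (n : ℕ) : 𝔼 → ℝ := dyadicBump (n + 1 : ℝ) (hpos n)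
  let ψ (n : ℕ) : 𝔼 → ℝ := fun x => χ n x * mollify g n x
  have hχs (n : ℕ) : ContDiff ℝ (⊤ : ℕ∞) (χ n) := ContDiffBump.contDiff _
  have hms (n : ℕ) : ContDiff ℝ (⊤ : ℕ∞) (mollify g n) := contDiff_mollify hg.continuous n
  have hψs (n : ℕ) : ContDiff ℝ (⊤ : ℕ∞) (ψ n) := (hχs n).mul (hms n)
  have hψc (n : ℕ) : HasCompactSupport (ψ n) := (ContDiffBump.hasCompactSupport _).mul_right
  have hfd (n : ℕ) (x : 𝔼) : fderiv ℝ (ψ n) x =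
      χ n x • fderiv ℝ (mollify g n) x + mollify g n x • fderiv ℝ (χ n) x :=
    fderiv_fun_mul ((hχs n).differentiable (by norm_cast) x)
      ((hms n).differentiable (by norm_cast) x)
  have hχ1 (n : ℕ) (x : 𝔼) : ‖χ n x‖ ≤ 1 := by
    rw [Real.norm_of_nonneg (ContDiffBump.nonneg _)]
    exact ContDiffBump.le_one _
  have hχ' (n : ℕ) (x : 𝔼) : ‖fderiv ℝ (χ n) x‖ ≤ C / (n + 1) := hC _ _ x
  have hbound (n : ℕ) (x : 𝔼) : ‖gradient (ψ n) x‖ ≤ K + B * C := by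
    rw [norm_gradient, hfd]
    refine (norm_add_le _ _).trans ?_
    rw [norm_smul, norm_smul]
    have h1 := norm_fderiv_le_of_lipschitz ℝ (lipschitzWith_mollify hg n) (x₀ := x)
    have h2 : ‖fderiv ℝ (χ n) x‖ ≤ C :=
      (hχ' n x).trans (div_le_self hC0.le (by linarith [(Nat.cast_nonneg n : (0 : ℝ) ≤ n)]))
    calc _ ≤ 1 * (K : ℝ) + B * C := by
          gcongr
          · exact hχ1 n x
          · exact norm_mollify_le hB n x
      _ = _ := by ring
  have hlim : ∀ᵐ x ∂μ.1, Tendsto (fun n => gradient (ψ n) x) atTop (𝓝 (gradient g x)) := by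
    filter_upwards [hd] with x hx
    refine ((InnerProductSpace.toDual ℝ 𝔼).symm.continuous.tendsto _).comp ?_
    simp_rw [hfd]
    have h1 : Tendsto (fun n => χ n x) atTop (𝓝 1) := by
      refine tendsto_const_nhds.congr' ?_
      filter_upwards [eventually_ge_atTop ⌈‖x‖⌉₊] with n hn
      refine (ContDiffBump.one_of_mem_closedBall _ ?_).symm
      rw [Metric.mem_closedBall, dist_zero_right]
      exact (Nat.ceil_le.1 hn).trans (by simp [dyadicBump])
    have h2 : Tendsto (fun n => mollify g n x • fderiv ℝ (χ n) x) atTop (𝓝 0) := by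
      refine squeeze_zero_norm (a := fun n : ℕ => B * (C * (1 / (n + 1 : ℝ)))) (fun n => ?_) ?_
      · rw [norm_smul]
        have := hχ' n x
        rw [div_eq_mul_one_div] at this
        gcongr
        exact norm_mollify_le hB n x
      · simpa using (tendsto_one_div_add_atTop_nhds_zero_nat.const_mul C).const_mul B
    simpa using (h1.smul (tendsto_fderiv_mollify hg.continuous hx)).add h2
  obtain ⟨hmem, happ⟩ := exists_eLpNorm_sub_lt_of_tendsto_of_bounded
    (fun n => (continuous_gradient_of_contDiff (hψs n)).aestronglyMeasurable) hbound hlim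
  refine ⟨hmem, fun ε hε => ?_⟩
  obtain ⟨n, hn⟩ := happ ε hε
  exact ⟨ψ n, hψs n, hψc n, hn⟩

/-- The tangent space is closed in `L²`. -/
theorem inTangentSpace_of_forall_exists_eLpNorm_sub_lt {μ : P2 p} {ζ : 𝔼 → 𝔼} (hζ : MemLp ζ 2 μ.1)
    (h : ∀ ε : ENNReal, 0 < ε →
      ∃ η, InTangentSpace μ η ∧ eLpNorm (fun x => ζ x - η x) 2 μ.1 < ε) :
    InTangentSpace μ ζ := by
  refine ⟨hζ, fun ε hε => ?_⟩
  obtain ⟨η, hη, h1⟩ := h (ε / 2) (ENNReal.half_pos hε.ne')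
  obtain ⟨ψ, hψ, hc, h2⟩ := hη.2 (ε / 2) (ENNReal.half_pos hε.ne')
  refine ⟨ψ, hψ, hc, ?_⟩
  have e : (fun x => ζ x - gradient ψ x) = (fun x => ζ x - η x) + fun x => η x - gradient ψ x := by
    ext1 x
    simp
  rw [e]
  refine (eLpNorm_add_le (hζ.sub hη.1).1 (hη.1.sub (memLp_gradient hψ hc μ)).1
    one_le_two).trans_lt ?_
  calc _ < ε / 2 + ε / 2 := ENNReal.add_lt_add h1 h2
    _ = ε := ENNReal.add_halves ε

theorem gradient_comp {T : 𝔼 → 𝔼} {g : 𝔼 → ℝ} {x : 𝔼} (hT : DifferentiableAt ℝ T x)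
    (hg : DifferentiableAt ℝ g (T x)) :
    gradient (g ∘ T) x = ContinuousLinearMap.adjoint (fderiv ℝ T x) (gradient g (T x)) := by
  refine ext_inner_right ℝ fun v => ?_
  rw [inner_gradient_eq_fderiv, ContinuousLinearMap.adjoint_inner_left, inner_gradient_eq_fderiv,
    fderiv_comp x hg hT]
  rfl

/-- Pulling back a tangent field by the transposed Jacobian yields a tangent field. -/
theorem InTangentSpace.adjoint_fderiv {T : 𝔼 → 𝔼} {K : NNReal} (hT : LipschitzWith K T) {μ : P2 p}
    (hd : ∀ᵐ x ∂μ.1, DifferentiableAt ℝ T x) {ξ : 𝔼 → 𝔼} (h : InTangentSpace (μ.map T hT) ξ) :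
    InTangentSpace μ (fun x => ContinuousLinearMap.adjoint (fderiv ℝ T x) (ξ (T x))) := by
  have hmp := measurePreserving_map hT μ
  have hξT : MemLp (fun x => ξ (T x)) 2 μ.1 := h.1.comp_measurePreserving hmp
  refine inTangentSpace_of_forall_exists_eLpNorm_sub_lt (memLp_adjoint_fderiv_apply hT hξT)
    fun ε hε => ?_
  have hK1 : (ENNReal.ofReal (K + 1)) ≠ 0 := by
    rw [ne_eq, ENNReal.ofReal_eq_zero, not_le]; positivity
  obtain ⟨ψ, hψ, hc, hlt⟩ := h.2 (ε / ENNReal.ofReal (K + 1))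
    (ENNReal.div_pos hε.ne' ENNReal.ofReal_ne_top)
  obtain ⟨Kψ, hKψ⟩ := (hψ.of_le (m := 1) (by norm_cast)).lipschitzWith_of_hasCompactSupport hc
    one_ne_zero
  obtain ⟨B, hB⟩ := hc.exists_bound_of_continuous hψ.continuous
  have hψd : Differentiable ℝ ψ := hψ.differentiable (by norm_cast)
  refine ⟨gradient (ψ ∘ T), inTangentSpace_gradient_of_lipschitzWith (hKψ.comp hT)
    (fun x => hB (T x)) (hd.mono fun x hx => (hψd _).comp x hx), ?_⟩
  have hle : ∀ᵐ x ∂μ.1, ‖ContinuousLinearMap.adjoint (fderiv ℝ T x) (ξ (T x)) -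
      gradient (ψ ∘ T) x‖ ≤ (K + 1) * ‖ξ (T x) - gradient ψ (T x)‖ := by
    filter_upwards [hd] with x hx
    rw [gradient_comp hx (hψd _), ← map_sub]
    refine (norm_adjoint_fderiv_apply_le hT _ _).trans ?_
    gcongr
    linarith
  have hsub : MemLp (fun x => ξ x - gradient ψ x) 2 (μ.map T hT).1 :=
    h.1.sub (memLp_gradient hψ hc _)
  have hcomp : eLpNorm (fun x => ξ (T x) - gradient ψ (T x)) 2 μ.1 =
      eLpNorm (fun x => ξ x - gradient ψ x) 2 (μ.map T hT).1 :=
    eLpNorm_comp_measurePreserving hsub.1 hmp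
  refine (eLpNorm_le_mul_eLpNorm_of_ae_le_mul hle 2).trans_lt ?_
  rw [hcomp, mul_comm]
  exact (ENNReal.lt_div_iff_mul_lt (Or.inl hK1) (Or.inl ENNReal.ofReal_ne_top)).1 hlt

/-! ### Perturbations of a density -/

/-- The measure with density `f` with respect to Lebesgue measure. -/
noncomputable def densityMeasure (f : EuclideanSpace ℝ (Fin p) → ℝ) :
    Measure (EuclideanSpace ℝ (Fin p)) :=
  volume.withDensity fun x => ENNReal.ofReal (f x)

section DensityMeasure

variable {f g : EuclideanSpace ℝ (Fin p) → ℝ}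

theorem densityMeasure_add (hf : Measurable f) (hf0 : ∀ x, 0 ≤ f x) (hg0 : ∀ x, 0 ≤ g x) :
    densityMeasure f + densityMeasure g = densityMeasure fun x => f x + g x := by
  rw [densityMeasure, densityMeasure, densityMeasure,
    ← withDensity_add_left (by fun_prop : Measurable fun x => ENNReal.ofReal (f x))]
  congr 1
  ext x
  exact (ENNReal.ofReal_add (hf0 x) (hg0 x)).symm

theorem smul_densityMeasure (hf : Measurable f) {a : ℝ} (ha : 0 ≤ a) :
    ENNReal.ofReal a • densityMeasure f = densityMeasure fun x => a * f x := by
  rw [densityMeasure, densityMeasure,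
    ← withDensity_smul _ (by fun_prop : Measurable fun x => ENNReal.ofReal (f x))]
  congr 1
  ext x
  simp [ENNReal.ofReal_mul ha]

theorem map_add_right_densityMeasure (hf : Measurable f) (w : 𝔼) :
    (densityMeasure f).map (fun x => x + w) = densityMeasure fun x => f (x - w) := by
  ext s hs
  rw [Measure.map_apply (by fun_prop) hs, densityMeasure, densityMeasure, withDensity_apply _ hs,
    withDensity_apply _ (hs.preimage (by fun_prop))]
  have := (measurePreserving_add_right (volume : Measure 𝔼) w).setLIntegral_comp_preimage hs
    (f := fun x => ENNReal.ofReal (f (x - w))) (by fun_prop)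
  simpa using this

theorem densityMeasure_univ (hf0 : ∀ x, 0 ≤ f x) (hi : Integrable f) :
    densityMeasure f Set.univ = ENNReal.ofReal (∫ x, f x) := by
  rw [densityMeasure, withDensity_apply _ MeasurableSet.univ, setLIntegral_univ,
    ofReal_integral_eq_lintegral_ofReal hi (Eventually.of_forall hf0)]

theorem ae_mem_densityMeasure (hf : Measurable f) {B : Set 𝔼} (hB : ∀ x ∉ B, f x = 0) :
    ∀ᵐ x ∂(densityMeasure f), x ∈ B := by
  rw [densityMeasure, ae_withDensity_iff (by fun_prop)]
  refine Eventually.of_forall fun x hx => ?_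
  by_contra h
  exact hx (by rw [hB x h, ENNReal.ofReal_zero])

theorem integral_densityMeasure (hf : Measurable f) (hf0 : ∀ x, 0 ≤ f x) (u : 𝔼 → ℝ) :
    ∫ x, u x ∂(densityMeasure f) = ∫ x, f x * u x := by
  rw [densityMeasure, integral_withDensity_eq_integral_toReal_smul (by fun_prop)
    (Eventually.of_forall fun _ => ENNReal.ofReal_lt_top)]
  simp [ENNReal.toReal_ofReal (hf0 _)]

theorem integrable_densityMeasure_iff (hf : Measurable f) (hf0 : ∀ x, 0 ≤ f x) {u : 𝔼 → ℝ} :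
    Integrable u (densityMeasure f) ↔ Integrable fun x => f x * u x := by
  rw [densityMeasure, integrable_withDensity_iff_integrable_smul' (by fun_prop)
    (Eventually.of_forall fun _ => ENNReal.ofReal_lt_top)]
  simp [ENNReal.toReal_ofReal (hf0 _)]

end DensityMeasure

/-- Two finite measures of the same mass have a coupling: the normalized product. -/
theorem exists_coupling_of_measure_univ_eq (α β : Measure 𝔼) [IsFiniteMeasure α]
    [IsFiniteMeasure β] (h : α Set.univ = β Set.univ) :
    ∃ Q : Measure (𝔼 × 𝔼), Q.map Prod.fst = α ∧ Q.map Prod.snd = β := by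
  by_cases h0 : α Set.univ = 0
  · refine ⟨0, ?_, ?_⟩
    · rw [Measure.map_zero]
      exact (Measure.measure_univ_eq_zero.1 h0).symm
    · rw [Measure.map_zero]
      exact (Measure.measure_univ_eq_zero.1 (h.symm.trans h0)).symm
  · refine ⟨(α Set.univ)⁻¹ • α.prod β, ?_, ?_⟩
    · rw [Measure.map_smul, Measure.map_fst_prod, smul_smul, ← h,
        ENNReal.inv_mul_cancel h0 (measure_ne_top _ _), one_smul]
    · rw [Measure.map_smul, Measure.map_snd_prod, smul_smul,
        ENNReal.inv_mul_cancel h0 (measure_ne_top _ _), one_smul]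

/-- The data of a perturbation `ρ - t k` of the density `ρ`, for `t ∈ [0, 1]`, which agrees up to
`c t²` with the effect of translating the part `h` of `ρ` by `t v`; everything takes place in the
compact set `B`. -/
structure IsTransportBump (ρ h k : EuclideanSpace ℝ (Fin p) → ℝ) (v : EuclideanSpace ℝ (Fin p))
    (B : Set (EuclideanSpace ℝ (Fin p))) (c : ℝ) : Prop where
  continuous_density : Continuous ρ
  density_nonneg : ∀ x, 0 ≤ ρ x
  continuous_bump : Continuous h
  continuous_perturbation : Continuous k
  bump_nonneg : ∀ x, 0 ≤ h x
  const_nonneg : 0 ≤ c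
  isCompact : IsCompact B
  le_density : ∀ x ∈ B, h x + c + |k x| ≤ ρ x
  abs_sub_le : ∀ t ∈ Set.Icc (0 : ℝ) 1, ∀ x, |h x - h (x - t • v) - t * k x| ≤ c * t ^ 2
  bump_eq_zero : ∀ t ∈ Set.Icc (0 : ℝ) 1, ∀ x ∉ B, h (x - t • v) = 0
  perturbation_eq_zero : ∀ x ∉ B, k x = 0
  integral_perturbation : ∫ x, k x = 0

namespace IsTransportBump

variable {ρ h k : EuclideanSpace ℝ (Fin p) → ℝ} {v : EuclideanSpace ℝ (Fin p)}
  {B : Set (EuclideanSpace ℝ (Fin p))} {c : ℝ}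

theorem bump_eq_zero' (H : IsTransportBump ρ h k v B c) {x : 𝔼} (hx : x ∉ B) : h x = 0 := by
  simpa using H.bump_eq_zero 0 ⟨le_rfl, zero_le_one⟩ x hx

theorem perturbation_le (H : IsTransportBump ρ h k v B c) (x : 𝔼) : |k x| ≤ ρ x := by
  by_cases hx : x ∈ B
  · linarith [H.le_density x hx, H.bump_nonneg x, H.const_nonneg]
  · rw [H.perturbation_eq_zero x hx, abs_zero]
    exact H.density_nonneg x

theorem hasCompactSupport_perturbation (H : IsTransportBump ρ h k v B c) : HasCompactSupport k :=
  HasCompactSupport.intro H.isCompact H.perturbation_eq_zero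

theorem hasCompactSupport_bump (H : IsTransportBump ρ h k v B c) : HasCompactSupport h :=
  HasCompactSupport.intro H.isCompact fun _ hx => H.bump_eq_zero' hx

theorem integrable_perturbation (H : IsTransportBump ρ h k v B c) : Integrable k :=
  H.continuous_perturbation.integrable_of_hasCompactSupport H.hasCompactSupport_perturbation

theorem integrable_bump (H : IsTransportBump ρ h k v B c) : Integrable h :=
  H.continuous_bump.integrable_of_hasCompactSupport H.hasCompactSupport_bump

theorem sub_nonneg (H : IsTransportBump ρ h k v B c) (x : 𝔼) : 0 ≤ ρ x - k x := by
  linarith [H.perturbation_le x, le_abs_self (k x)]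

/-- The perturbed density `ρ - k` is the density of a measure in `P2`. -/
theorem exists_eq_densityMeasure (H : IsTransportBump ρ h k v B c) {μ : P2 p}
    (hμ : μ.1 = densityMeasure ρ) : ∃ ν : P2 p, ν.1 = densityMeasure fun x => ρ x - k x := by
  have hρc := H.continuous_density
  have hkc := H.continuous_perturbation
  have hm : Measurable fun x => ρ x - k x := by fun_prop
  have hρi : Integrable ρ := by
    have h1 : Integrable (fun _ => (1 : ℝ)) (densityMeasure ρ) := hμ ▸ integrable_const (1 : ℝ)
    simpa using (integrable_densityMeasure_iff (by fun_prop) H.density_nonneg).1 h1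
  refine ⟨⟨densityMeasure fun x => ρ x - k x, ⟨?_⟩, ?_⟩, rfl⟩
  · rw [densityMeasure_univ H.sub_nonneg (hρi.sub H.integrable_perturbation),
      integral_sub hρi H.integrable_perturbation, H.integral_perturbation, sub_zero,
      ← densityMeasure_univ H.density_nonneg hρi, ← hμ, measure_univ]
  · rw [integrable_densityMeasure_iff hm H.sub_nonneg]
    have h2 := μ.2.2
    rw [hμ, integrable_densityMeasure_iff (by fun_prop) H.density_nonneg] at h2
    have h3 : Integrable fun x : 𝔼 => k x * ‖x‖ ^ 2 :=
      Continuous.integrable_of_hasCompactSupport (by fun_prop)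
        H.hasCompactSupport_perturbation.mul_right
    refine (h2.sub h3).congr (Eventually.of_forall fun x => ?_)
    simp only [Pi.sub_apply]
    ring

theorem mix_eq_densityMeasure (H : IsTransportBump ρ h k v B c) {μ ν : P2 p}
    (hμ : μ.1 = densityMeasure ρ) (hν : ν.1 = densityMeasure fun x => ρ x - k x)
    (t : unitInterval) : (P2.mix μ ν t).1 = densityMeasure fun x => ρ x - t * k x := by
  have hρc := H.continuous_density
  have hkc := H.continuous_perturbation
  have ht := t.2.1
  have ht' : (0 : ℝ) ≤ 1 - t := by linarith [t.2.2]
  have e : (P2.mix μ ν t).1 = ENNReal.ofReal (1 - t) • μ.1 + ENNReal.ofReal t • ν.1 := rfl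
  rw [e, hμ, hν, smul_densityMeasure (by fun_prop) ht', smul_densityMeasure (by fun_prop) ht,
    densityMeasure_add (by fun_prop) (fun x => mul_nonneg ht' (H.density_nonneg x))
      (fun x => mul_nonneg ht (H.sub_nonneg x))]
  congr 1
  ext x
  ring

/-- A coupling of `ρ` and `ρ - t k` with cost `O(t²)`: translate the part `h` of the mass by `t v`,
couple the remaining discrepancy, of mass `O(t²)`, arbitrarily inside `B`, and leave the rest of the
mass in place. -/
theorem exists_coupling (H : IsTransportBump ρ h k v B c) {μ : P2 p}
    (hμ : μ.1 = densityMeasure ρ) {ξ : 𝔼 → 𝔼} (hξ : MemLp ξ 2 μ.1) :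
    ∃ C : ℝ, 0 ≤ C ∧ ∀ t ∈ Set.Icc (0 : ℝ) 1, ∀ ν : P2 p,
      ν.1 = densityMeasure (fun x => ρ x - t * k x) →
      ∃ γ ∈ couplings μ ν, √(transportCost γ) ≤ C * t ∧
        |∫ z, inner ℝ (ξ z.1) (z.2 - z.1) ∂γ - t * ∫ x, h x * inner ℝ (ξ x) v| ≤ C * t ^ 2 := by
  have hρc := H.continuous_density
  have hkc := H.continuous_perturbation
  have hhc := H.continuous_bump
  have hBm : MeasurableSet B := H.isCompact.measurableSet
  have hc0 := H.const_nonneg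
  set d := Metric.diam B with hd
  have hd0 : 0 ≤ d := Metric.diam_nonneg
  have hdB : ∀ x ∈ B, ∀ y ∈ B, ‖x - y‖ ≤ d := fun x hx y hy => by
    rw [← dist_eq_norm]
    exact Metric.dist_le_diam_of_mem H.isCompact.isBounded hx hy
  set Ih := ∫ x, h x with hIh
  have hIh0 : 0 ≤ Ih := integral_nonneg H.bump_nonneg
  set V := volume.real B with hV
  have hV0 : 0 ≤ V := measureReal_nonneg
  set J := ∫ x, B.indicator (fun _ => (1 : ℝ)) x * ‖ξ x‖ with hJ
  have hone0 : ∀ x, 0 ≤ B.indicator (fun _ => (1 : ℝ)) x :=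
    Set.indicator_nonneg fun _ _ => zero_le_one
  have hJ0 : 0 ≤ J := integral_nonneg fun x => mul_nonneg (hone0 x) (norm_nonneg _)
  have honem : Measurable (B.indicator fun _ => (1 : ℝ)) := measurable_const.indicator hBm
  have honei : Integrable (B.indicator fun _ => (1 : ℝ)) := by
    rw [integrable_indicator_iff hBm]
    exact integrableOn_const H.isCompact.measure_lt_top.ne
  have hone1 : ∫ x, B.indicator (fun _ => (1 : ℝ)) x = V := by
    rw [integral_indicator_const _ hBm, smul_eq_mul, mul_one]
  refine ⟨max √(‖v‖ ^ 2 * Ih + d ^ 2 * (c * V)) (d * (c * J)), by positivity,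
    fun t ht ν hν => ?_⟩
  obtain ⟨ht0, ht1⟩ := ht
  have ht2 : t ^ 2 ≤ 1 := pow_le_one₀ ht0 ht1
  have hct : c * t ^ 2 ≤ c := mul_le_of_le_one_right hc0 ht2
  -- The densities of the mass at rest and of the two marginals of the discrepancy. Adding the
  -- multiple `c t²` of the indicator of `B` to both marginals makes the second one nonnegative.
  set f₀ : 𝔼 → ℝ := fun x => ρ x - h x - c * t ^ 2 * B.indicator (fun _ => (1 : ℝ)) x with hf₀
  set a : 𝔼 → ℝ := fun x => c * t ^ 2 * B.indicator (fun _ => (1 : ℝ)) x with ha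
  set b : 𝔼 → ℝ := fun x => a x + (h x - h (x - t • v) - t * k x) with hb
  have hf₀m : Measurable f₀ := by fun_prop
  have ham : Measurable a := by fun_prop
  have hbm : Measurable b := by fun_prop
  have hhm : Measurable h := by fun_prop
  have hf₀0 : ∀ x, 0 ≤ f₀ x := by
    intro x
    simp only [hf₀]
    by_cases hx : x ∈ B
    · rw [Set.indicator_of_mem hx]
      linarith [H.le_density x hx, abs_nonneg (k x)]
    · rw [Set.indicator_of_notMem hx, H.bump_eq_zero' hx]
      linarith [H.density_nonneg x]
  have ha0 : ∀ x, 0 ≤ a x := fun x => mul_nonneg (by positivity) (hone0 x)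
  have haB : ∀ x ∉ B, a x = 0 := fun x hx => by
    simp only [ha, Set.indicator_of_notMem hx, mul_zero]
  have hbB : ∀ x ∉ B, b x = 0 := fun x hx => by
    simp only [hb, haB x hx, H.bump_eq_zero' hx, H.bump_eq_zero t ⟨ht0, ht1⟩ x hx,
      H.perturbation_eq_zero x hx]
    ring
  have hb0 : ∀ x, 0 ≤ b x := by
    intro x
    by_cases hx : x ∈ B
    · have := (abs_le.1 (H.abs_sub_le t ⟨ht0, ht1⟩ x)).1
      simp only [hb, ha, Set.indicator_of_mem hx]
      linarith
    · rw [hbB x hx]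
  have hai : Integrable a := honei.const_mul _
  have hri : Integrable fun x => h x - h (x - t • v) - t * k x :=
    (H.integrable_bump.sub (H.integrable_bump.comp_sub_right _)).sub
      (H.integrable_perturbation.const_mul t)
  have hbi : Integrable b := hai.add hri
  have haint : ∫ x, a x = c * t ^ 2 * V := by rw [integral_const_mul, hone1]
  have hbint : ∫ x, b x = c * t ^ 2 * V := by
    have i1 : Integrable fun x => h (x - t • v) := H.integrable_bump.comp_sub_right _
    have i2 : Integrable fun x => h x - h (x - t • v) := H.integrable_bump.sub i1
    rw [integral_add hai hri, haint, integral_sub i2 (H.integrable_perturbation.const_mul t),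
      integral_sub H.integrable_bump i1, integral_sub_right_eq_self (fun x => h x),
      integral_const_mul, H.integral_perturbation]
    ring
  have hau : densityMeasure a Set.univ = ENNReal.ofReal (c * t ^ 2 * V) := by
    rw [densityMeasure_univ ha0 hai, haint]
  have hbu : densityMeasure b Set.univ = ENNReal.ofReal (c * t ^ 2 * V) := by
    rw [densityMeasure_univ hb0 hbi, hbint]
  have : IsFiniteMeasure (densityMeasure a) := ⟨by rw [hau]; exact ENNReal.ofReal_lt_top⟩
  have : IsFiniteMeasure (densityMeasure b) := ⟨by rw [hbu]; exact ENNReal.ofReal_lt_top⟩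
  obtain ⟨Q, hQ1, hQ2⟩ := exists_coupling_of_measure_univ_eq _ _ (hau.trans hbu.symm)
  have hQu : Q Set.univ = ENNReal.ofReal (c * t ^ 2 * V) := by
    rw [← hau, ← hQ1, Measure.map_apply measurable_fst MeasurableSet.univ, Set.preimage_univ]
  have hQd : ∀ᵐ z ∂Q, ‖z.1 - z.2‖ ≤ d := by
    have h1 : ∀ᵐ z ∂Q, z.1 ∈ B := by
      refine ae_of_ae_map (f := Prod.fst) (by fun_prop) (p := fun x => x ∈ B) ?_
      rw [hQ1]
      exact ae_mem_densityMeasure ham haB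
    have h2 : ∀ᵐ z ∂Q, z.2 ∈ B := by
      refine ae_of_ae_map (f := Prod.snd) (by fun_prop) (p := fun x => x ∈ B) ?_
      rw [hQ2]
      exact ae_mem_densityMeasure hbm hbB
    filter_upwards [h1, h2] with z hz1 hz2 using hdB _ hz1 _ hz2
  have hm1 : Measurable fun x : 𝔼 => (x, x) := by fun_prop
  have hm2 : Measurable fun x : 𝔼 => (x, x + t • v) := by fun_prop
  set D := (densityMeasure f₀).map fun x => (x, x) with hD
  set M := (densityMeasure h).map fun x => (x, x + t • v) with hM
  have hγ : D + M + Q ∈ couplings μ ν := by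
    constructor
    · rw [Measure.map_add _ _ measurable_fst, Measure.map_add _ _ measurable_fst, hD, hM,
        Measure.map_map measurable_fst hm1, Measure.map_map measurable_fst hm2, hQ1]
      have e1 : (densityMeasure f₀).map (Prod.fst ∘ fun x => (x, x)) = densityMeasure f₀ :=
        Measure.map_id
      have e2 : (densityMeasure h).map (Prod.fst ∘ fun x => (x, x + t • v)) = densityMeasure h :=
        Measure.map_id
      rw [e1, e2, densityMeasure_add hf₀m hf₀0 H.bump_nonneg,
        densityMeasure_add (f := fun x => f₀ x + h x) (by fun_prop)
          (fun x => add_nonneg (hf₀0 x) (H.bump_nonneg x)) ha0, hμ]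
      congr 1
      ext x
      simp only [hf₀, ha]
      ring
    · rw [Measure.map_add _ _ measurable_snd, Measure.map_add _ _ measurable_snd, hD, hM,
        Measure.map_map measurable_snd hm1, Measure.map_map measurable_snd hm2, hQ2]
      have e1 : (densityMeasure f₀).map (Prod.snd ∘ fun x => (x, x)) = densityMeasure f₀ :=
        Measure.map_id
      have e2 : (densityMeasure h).map (Prod.snd ∘ fun x => (x, x + t • v)) =
          densityMeasure fun x => h (x - t • v) := map_add_right_densityMeasure hhm _
      rw [e1, e2, densityMeasure_add hf₀m hf₀0 (fun x => H.bump_nonneg _),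
        densityMeasure_add (f := fun x => f₀ x + h (x - t • v)) (by fun_prop)
          (fun x => add_nonneg (hf₀0 x) (H.bump_nonneg _)) hb0, hν]
      congr 1
      ext x
      simp only [hf₀, hb, ha]
      ring
  refine ⟨D + M + Q, hγ, ?_, ?_⟩
  · have hle : ∫⁻ z, ENNReal.ofReal (‖z.1 - z.2‖ ^ 2) ∂(D + M + Q) ≤
        ENNReal.ofReal ((‖v‖ ^ 2 * Ih + d ^ 2 * (c * V)) * t ^ 2) := by
      rw [lintegral_add_measure, lintegral_add_measure, hD, hM,
        lintegral_map (by fun_prop) hm1, lintegral_map (by fun_prop) hm2]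
      have c1 : ∫⁻ x : 𝔼, ENNReal.ofReal (‖x - x‖ ^ 2) ∂(densityMeasure f₀) = 0 := by simp
      have c2 : ∫⁻ x : 𝔼, ENNReal.ofReal (‖x - (x + t • v)‖ ^ 2) ∂(densityMeasure h) =
          ENNReal.ofReal (‖v‖ ^ 2 * t ^ 2 * Ih) := by
        have : ∀ x : 𝔼, ‖x - (x + t • v)‖ ^ 2 = ‖v‖ ^ 2 * t ^ 2 := fun x => by
          rw [sub_add_cancel_left, norm_neg, norm_smul, mul_pow, Real.norm_eq_abs, sq_abs, mul_comm]
        simp_rw [this]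
        rw [lintegral_const, densityMeasure_univ H.bump_nonneg H.integrable_bump,
          ← ENNReal.ofReal_mul (by positivity)]
      have c3 : ∫⁻ z, ENNReal.ofReal (‖z.1 - z.2‖ ^ 2) ∂Q ≤
          ENNReal.ofReal (d ^ 2 * (c * t ^ 2 * V)) := by
        calc _ ≤ ∫⁻ _, ENNReal.ofReal (d ^ 2) ∂Q := by
              refine lintegral_mono_ae ?_
              filter_upwards [hQd] with z hz
              gcongr
          _ = _ := by rw [lintegral_const, hQu, ← ENNReal.ofReal_mul (by positivity)]
      rw [c1, c2, zero_add]
      calc _ ≤ ENNReal.ofReal (‖v‖ ^ 2 * t ^ 2 * Ih) +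
            ENNReal.ofReal (d ^ 2 * (c * t ^ 2 * V)) := by
            gcongr
        _ = _ := by
            rw [← ENNReal.ofReal_add (by positivity) (by positivity)]
            congr 1
            ring
    have hcost : transportCost (D + M + Q) ≤ (‖v‖ ^ 2 * Ih + d ^ 2 * (c * V)) * t ^ 2 := by
      rw [transportCost_eq_toReal_lintegral]
      exact (ENNReal.toReal_mono ENNReal.ofReal_ne_top hle).trans_eq
        (ENNReal.toReal_ofReal (by positivity))
    refine (Real.sqrt_le_sqrt hcost).trans ?_
    rw [Real.sqrt_mul (by positivity), Real.sqrt_sq ht0]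
    gcongr
    exact le_max_left _ _
  · have hprob := isProbabilityMeasure_of_mem_couplings hγ
    have hi := integrable_inner_of_memLp (memLp_comp_fst hγ hξ) (memLp_displacement hγ)
    have hiQ := hi.right_of_add_measure
    have hiD := hi.left_of_add_measure.left_of_add_measure
    have hiM := hi.left_of_add_measure.right_of_add_measure
    have hn : Integrable (fun z : 𝔼 × 𝔼 => ‖ξ z.1‖) Q :=
      ((memLp_comp_fst hγ hξ).integrable one_le_two).norm.right_of_add_measure
    rw [integral_add_measure hi.left_of_add_measure hiQ, integral_add_measure hiD hiM]
    have e1 : ∫ z, inner ℝ (ξ z.1) (z.2 - z.1) ∂D = 0 := by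
      rw [hD, integral_map hm1.aemeasurable hiD.1]
      simp
    have e2 : ∫ z, inner ℝ (ξ z.1) (z.2 - z.1) ∂M = t * ∫ x, h x * inner ℝ (ξ x) v := by
      rw [hM, integral_map hm2.aemeasurable hiM.1, ← integral_const_mul]
      simp only [add_sub_cancel_left, inner_smul_right]
      rw [integral_densityMeasure hhm H.bump_nonneg]
      congr 1
      ext x
      ring
    rw [e1, e2, zero_add, add_sub_cancel_left, ← Real.norm_eq_abs]
    have e3 : ∫ z : 𝔼 × 𝔼, d * ‖ξ z.1‖ ∂Q = d * (c * J) * t ^ 2 := by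
      have hξm : AEStronglyMeasurable (fun x => ‖ξ x‖) (Q.map Prod.fst) := by
        refine (hξ.1.mono_measure ?_).norm
        rw [← hγ.1]
        exact Measure.map_mono (Measure.le_add_left le_rfl) measurable_fst
      have := integral_map (μ := Q) (φ := Prod.fst) measurable_fst.aemeasurable hξm
      rw [integral_const_mul, ← this, hQ1, integral_densityMeasure ham ha0, hJ]
      simp only [ha, mul_assoc]
      rw [integral_const_mul, integral_const_mul]
      ring
    refine (norm_integral_le_of_norm_le (hn.const_mul d) ?_).trans ?_
    · filter_upwards [hQd] with z hz
      refine (norm_inner_le_norm _ _).trans ?_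
      rw [norm_sub_rev, mul_comm]
      gcongr
    · rw [e3]
      gcongr
      exact le_max_right _ _

end IsTransportBump

/-! ### First variations and strong gradients -/

/-- Comparison of the two derivatives of `F` along `ρ - t k`: the first variation gives
`-∫ φ k`, the strong gradient gives `∫ h ⟨ξ, v⟩`. -/
theorem IsTransportBump.integral_perturbation_mul_firstVariation {ρ h k : 𝔼 → ℝ} {v : 𝔼} {B : Set 𝔼}
    {c : ℝ} (H : IsTransportBump ρ h k v B c) {μ : P2 p} (hμ : μ.1 = densityMeasure ρ)
    {F : P2 p → ℝ} {ξ : 𝔼 → 𝔼} (hF : IsStrongGradient F μ ξ) {φ : 𝔼 → ℝ}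
    (hφ : IsFirstVariation F μ φ) :
    Integrable (fun x => k x * φ x) ∧
      ∫ x, k x * φ x = -∫ x, h x * inner ℝ (ξ x) v := by
  obtain ⟨ν, hν⟩ := H.exists_eq_densityMeasure hμ
  have hρc := H.continuous_density
  have hkc := H.continuous_perturbation
  have hm : Measurable fun x => ρ x - k x := by fun_prop
  have i1 := hφ.1 μ
  have i2 := hφ.1 ν
  have d1 : ∫ x, φ x ∂μ.1 = ∫ x, ρ x * φ x := by
    rw [hμ, integral_densityMeasure (by fun_prop) H.density_nonneg]
  have d2 : ∫ x, φ x ∂ν.1 = ∫ x, (ρ x - k x) * φ x := by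
    rw [hν, integral_densityMeasure hm H.sub_nonneg]
  rw [hμ, integrable_densityMeasure_iff (by fun_prop) H.density_nonneg] at i1
  rw [hν, integrable_densityMeasure_iff hm H.sub_nonneg] at i2
  have e : (fun x => k x * φ x) = fun x => ρ x * φ x - (ρ x - k x) * φ x := by
    ext x
    ring
  refine ⟨e ▸ i1.sub i2, ?_⟩
  obtain ⟨C, hC0, hC⟩ := H.exists_coupling hμ hF.1
  have ht (n : ℕ) : (0 : ℝ) < 1 / (n + 1) := by positivity
  have ht1 (n : ℕ) : (1 : ℝ) / (n + 1) ≤ 1 := by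
    rw [div_le_one (by positivity)]
    linarith [(Nat.cast_nonneg n : (0 : ℝ) ≤ n)]
  let t (n : ℕ) : unitInterval := ⟨1 / (n + 1), (ht n).le, ht1 n⟩
  choose γ hγ hcost hint using fun n =>
    hC (t n) (t n).2 (P2.mix μ ν (t n)) (H.mix_eq_densityMeasure hμ hν (t n))
  have htlim : Tendsto (fun n => (t n : ℝ)) atTop (𝓝 0) :=
    tendsto_one_div_add_atTop_nhds_zero_nat
  have l1 : Tendsto (fun n => (F (P2.mix μ ν (t n)) - F μ) / (t n : ℝ)) atTop
      (𝓝 (∫ x, h x * inner ℝ (ξ x) v)) := by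
    refine hF.tendsto_div hγ ht htlim hcost ?_
    rw [tendsto_iff_dist_tendsto_zero]
    refine squeeze_zero (fun _ => dist_nonneg) (g := fun n => C * (t n : ℝ)) (fun n => ?_)
      (by simpa using htlim.const_mul C)
    have htn : (0 : ℝ) < t n := ht n
    have e2 : (∫ z, inner ℝ (ξ z.1) (z.2 - z.1) ∂(γ n)) / (t n : ℝ) -
        ∫ x, h x * inner ℝ (ξ x) v = (∫ z, inner ℝ (ξ z.1) (z.2 - z.1) ∂(γ n) -
          (t n : ℝ) * ∫ x, h x * inner ℝ (ξ x) v) / t n := by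
      field_simp
    rw [Real.dist_eq, e2, abs_div, abs_of_pos htn, div_le_iff₀ htn]
    refine (hint n).trans_eq ?_
    ring
  have l2 : Tendsto (fun n => (F (P2.mix μ ν (t n)) - F μ) / (t n : ℝ)) atTop
      (𝓝 ((∫ x, φ x ∂ν.1) - ∫ x, φ x ∂μ.1)) := by
    refine (hφ.2 ν).comp (tendsto_nhdsWithin_iff.2 ⟨?_, Eventually.of_forall fun n => ht n⟩)
    exact tendsto_subtype_rng.2 htlim
  have key := tendsto_nhds_unique l1 l2
  rw [e, integral_sub i1 i2, key, d1, d2]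
  ring

theorem integral_fderiv_apply_eq_zero {h : 𝔼 → ℝ} (hh : ContDiff ℝ 1 h)
    (hc : HasCompactSupport h) (v : 𝔼) : ∫ x, fderiv ℝ h x v = 0 := by
  have hd : Differentiable ℝ h := hh.differentiable one_ne_zero
  have hh' := hh.continuous_fderiv one_ne_zero
  have hc' : HasCompactSupport fun x => fderiv ℝ h x v :=
    (hc.fderiv ℝ).comp_left (g := fun A : 𝔼 →L[ℝ] ℝ => A v) rfl
  have := integral_mul_fderiv_eq_neg_fderiv_mul_of_integrable (μ := (volume : Measure 𝔼))
    (f := fun _ => (1 : ℝ)) (g := h) (v := v) (by simp)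
    (by simpa using Continuous.integrable_of_hasCompactSupport (by fun_prop) hc')
    (by simpa using hh.continuous.integrable_of_hasCompactSupport hc)
    (fun x _ => by fun_prop) (fun x _ => hd x)
  simpa using this

/-- After rescaling, any nonnegative test function supported where the density is positive gives
rise to a perturbation. -/
theorem exists_isTransportBump {ρ : 𝔼 → ℝ} (hρ : Continuous ρ) (hρ0 : ∀ x, 0 ≤ ρ x) {h : 𝔼 → ℝ}
    (hh : ContDiff ℝ (⊤ : ℕ∞) h) (hc : HasCompactSupport h) (hh0 : ∀ x, 0 ≤ h x)
    (hs : tsupport h ⊆ {x | 0 < ρ x}) (v : 𝔼) :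
    ∃ a > 0, ∃ s > 0, ∃ B c, IsTransportBump ρ (fun x => a * h x)
      (fun x => a * s * fderiv ℝ h x v) (s • v) B c := by
  have hh1 : ContDiff ℝ 1 h := hh.of_le (by norm_cast)
  have hh' := hh1.continuous_fderiv one_ne_zero
  have hhc := hh.continuous
  obtain ⟨δ, hδ, hsub⟩ := IsCompact.exists_cthickening_subset_open hc
    (isOpen_lt continuous_const hρ) hs
  have hBc : IsCompact (Metric.cthickening δ (tsupport h)) := IsCompact.cthickening hc
  obtain ⟨m, hm0, hm⟩ := hBc.exists_forall_le' hρ.continuousOn (a := 0) (fun x hx => hsub hx)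
  obtain ⟨C, hC0, hC⟩ := exists_taylor_bound_of_hasCompactSupport hh hc
  obtain ⟨M₁, hM₁⟩ := hc.exists_bound_of_continuous hh.continuous
  obtain ⟨M₂, hM₂⟩ := (hc.fderiv ℝ).exists_bound_of_continuous hh'
  have hM₁0 : 0 ≤ M₁ := (norm_nonneg _).trans (hM₁ 0)
  have hM₂0 : 0 ≤ M₂ := (norm_nonneg _).trans (hM₂ 0)
  set s := δ / (‖v‖ + 1) with hsdef
  have hs0 : 0 < s := by positivity
  have hsv : ‖s • v‖ ≤ δ := by
    rw [norm_smul, Real.norm_of_nonneg hs0.le, hsdef, div_mul_eq_mul_div,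
      div_le_iff₀ (by positivity)]
    gcongr
    linarith
  set a := m / (M₁ + C * δ ^ 2 + M₂ * δ + 1) with hadef
  have ha0 : 0 < a := by positivity
  have hfd (x : 𝔼) : |s * fderiv ℝ h x v| ≤ M₂ * δ := by
    have e : s * fderiv ℝ h x v = fderiv ℝ h x (s • v) := by simp
    rw [e, ← Real.norm_eq_abs]
    refine (ContinuousLinearMap.le_opNorm _ _).trans ?_
    gcongr
    exact hM₂ x
  have hmem {t : ℝ} (ht : t ∈ Set.Icc (0 : ℝ) 1) {x : 𝔼}
      (hx : x ∉ Metric.cthickening δ (tsupport h)) : x - t • s • v ∉ tsupport h := by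
    refine fun hmem => hx (Metric.mem_cthickening_of_dist_le x _ δ _ hmem ?_)
    rw [dist_eq_norm, sub_sub_cancel, norm_smul, Real.norm_of_nonneg ht.1]
    exact (mul_le_of_le_one_left (norm_nonneg _) ht.2).trans hsv
  have hk0 {x : 𝔼} (hx : x ∉ Metric.cthickening δ (tsupport h)) : fderiv ℝ h x v = 0 := by
    have : x ∉ tsupport (fderiv ℝ h) := fun hx' =>
      hmem (t := 0) ⟨le_rfl, zero_le_one⟩ hx (by simpa using tsupport_fderiv_subset ℝ hx')
    rw [image_eq_zero_of_notMem_tsupport this]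
    rfl
  refine ⟨a, ha0, s, hs0, Metric.cthickening δ (tsupport h), a * (C * δ ^ 2), ?_⟩
  refine
    { continuous_density := hρ
      density_nonneg := hρ0
      continuous_bump := by fun_prop
      continuous_perturbation := by fun_prop
      bump_nonneg := fun x => mul_nonneg ha0.le (hh0 x)
      const_nonneg := by positivity
      isCompact := hBc
      le_density := fun x hx => ?_
      abs_sub_le := fun t ht x => ?_
      bump_eq_zero := fun t ht x hx => ?_
      perturbation_eq_zero := fun x hx => by rw [hk0 hx, mul_zero]
      integral_perturbation := by
        rw [integral_const_mul, integral_fderiv_apply_eq_zero hh1 hc, mul_zero] }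
  · have h1 : h x ≤ M₁ := (le_abs_self _).trans (hM₁ x)
    rw [mul_assoc a s, abs_mul, abs_of_pos ha0]
    calc _ = a * (h x + C * δ ^ 2 + |s * fderiv ℝ h x v|) := by ring
      _ ≤ a * (M₁ + C * δ ^ 2 + M₂ * δ + 1) := by
          refine mul_le_mul_of_nonneg_left ?_ ha0.le
          linarith [hfd x]
      _ = m := by rw [hadef]; field_simp
      _ ≤ ρ x := hm x hx
  · have := hC x (x - t • s • v)
    rw [sub_sub_cancel_left, norm_neg, norm_smul, Real.norm_of_nonneg ht.1, mul_pow, map_neg,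
      map_smul, map_smul, smul_eq_mul, smul_eq_mul] at this
    have e : a * h x - a * h (x - t • s • v) - t * (a * s * fderiv ℝ h x v) =
        -(a * (h (x - t • s • v) - h x - -(t * (s * fderiv ℝ h x v)))) := by ring
    rw [e, abs_neg, abs_mul, abs_of_pos ha0]
    calc _ ≤ a * (C * (t ^ 2 * ‖s • v‖ ^ 2)) := by gcongr
      _ ≤ a * (C * (t ^ 2 * δ ^ 2)) := by gcongr
      _ = _ := by ring
  · rw [image_eq_zero_of_notMem_tsupport (hmem ht hx), mul_zero]

/-- Where the density is positive, the strong gradient is the weak gradient of the first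
variation. -/
theorem IsFirstVariation.integral_mul_fderiv {μ : P2 p} {ρ : 𝔼 → ℝ} (hρ : Continuous ρ)
    (hρ0 : ∀ x, 0 ≤ ρ x) (hμ : μ.1 = densityMeasure ρ) {F : P2 p → ℝ} {ξ : 𝔼 → 𝔼}
    (hF : IsStrongGradient F μ ξ) {φ : 𝔼 → ℝ} (hφ : IsFirstVariation F μ φ) {h : 𝔼 → ℝ}
    (hh : ContDiff ℝ (⊤ : ℕ∞) h) (hc : HasCompactSupport h) (hh0 : ∀ x, 0 ≤ h x)
    (hs : tsupport h ⊆ {x | 0 < ρ x}) (v : 𝔼) :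
    Integrable (fun x => φ x * fderiv ℝ h x v) ∧
      ∫ x, φ x * fderiv ℝ h x v = -∫ x, h x * inner ℝ (ξ x) v := by
  obtain ⟨a, ha, s, hs, B, c, H⟩ := exists_isTransportBump hρ hρ0 hh hc hh0 hs v
  obtain ⟨hi, he⟩ := H.integral_perturbation_mul_firstVariation hμ hF hφ
  have e1 : (fun x => a * s * fderiv ℝ h x v * φ x) =
      fun x => a * s * (φ x * fderiv ℝ h x v) := by
    ext x
    ring
  have e2 : (fun x => a * h x * inner ℝ (ξ x) (s • v)) =
      fun x => a * s * (h x * inner ℝ (ξ x) v) := by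
    ext x
    rw [inner_smul_right]
    ring
  rw [e1] at hi he
  rw [e2, integral_const_mul, integral_const_mul, ← mul_neg] at he
  refine ⟨?_, mul_left_cancel₀ (by positivity) he⟩
  rwa [integrable_const_mul_iff (by rw [isUnit_iff_ne_zero]; positivity)] at hi

/-- If the density is continuous, the strong gradient is the pointwise gradient of a first variation
that is differentiable almost everywhere: the mollifications of the first variation have gradients
converging to the pointwise gradient at points of differentiability, and to the weak gradient at
its Lebesgue points. -/
theorem IsStrongGradient.ae_eq_gradient {μ : P2 p} {ρ : 𝔼 → ℝ} (hρ : Continuous ρ)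
    (hρ0 : ∀ x, 0 ≤ ρ x) (hμ : μ.1 = densityMeasure ρ) {F : P2 p → ℝ} {ξ : 𝔼 → 𝔼}
    (hF : IsStrongGradient F μ ξ) {φ : 𝔼 → ℝ} (hφ : IsFirstVariation F μ φ)
    (hd : ∀ᵐ x ∂μ.1, DifferentiableAt ℝ φ x) : ξ =ᵐ[μ.1] gradient φ := by
  -- The field `ξ` is integrable for Lebesgue measure only where `ρ` is bounded below, so that its
  -- Lebesgue points are those of its restrictions to the sets `U n`, which exhaust `{ρ > 0}`.
  let U (n : ℕ) : Set 𝔼 := {x | 1 / (n + 1 : ℝ) < ρ x}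
  have hU (n : ℕ) : IsOpen (U n) := isOpen_lt continuous_const hρ
  have hρξ : Integrable fun x => ρ x • ξ x := by
    have h1 := hF.1.integrable one_le_two
    rw [hμ, densityMeasure, integrable_withDensity_iff_integrable_smul' (by fun_prop)
      (Eventually.of_forall fun _ => ENNReal.ofReal_lt_top)] at h1
    simpa [ENNReal.toReal_ofReal (hρ0 _)] using h1
  have hξU (n : ℕ) : Integrable ((U n).indicator ξ) := by
    have e : (U n).indicator ξ = (U n).indicator fun x => (ρ x)⁻¹ • ρ x • ξ x := by
      refine Set.indicator_congr fun x hx => ?_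
      have hx' : 0 < ρ x := lt_trans (by positivity) (show 1 / (n + 1 : ℝ) < ρ x from hx)
      rw [inv_smul_smul₀ hx'.ne']
    refine (hρξ.norm.const_mul (n + 1 : ℝ)).mono' ?_ (Eventually.of_forall fun x => ?_)
    · rw [e]
      exact ((by fun_prop : Measurable fun x => (ρ x)⁻¹).aestronglyMeasurable.smul
        hρξ.1).indicator (hU n).measurableSet
    · by_cases hx : x ∈ U n
      · have hx' : 1 / (n + 1 : ℝ) < ρ x := hx
        rw [Set.indicator_of_mem hx, norm_smul, Real.norm_of_nonneg (hρ0 x), ← mul_assoc]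
        refine le_mul_of_one_le_left (norm_nonneg _) ?_
        rw [div_lt_iff₀' (by positivity)] at hx'
        exact hx'.le
      · rw [Set.indicator_of_notMem hx, norm_zero]
        positivity
  let κ (m : ℕ) : ContDiffBump (0 : 𝔼) := dyadicBump (1 / (m + 1 : ℝ)) (by positivity)
  have hrad : Tendsto (fun m => (κ m).rOut) atTop (𝓝 0) := by
    simpa [κ, dyadicBump] using
      tendsto_one_div_add_atTop_nhds_zero_nat.const_mul (2 : ℝ)
  have hleb : ∀ᵐ x, ∀ n, Tendsto
      (fun m => convolution (mollifier m) ((U n).indicator ξ) (ContinuousLinearMap.lsmul ℝ ℝ)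
        volume x) atTop (𝓝 ((U n).indicator ξ x)) :=
    ae_all_iff.2 fun n => ContDiffBump.ae_convolution_tendsto_right_of_locallyIntegrable
      (φ := κ) (K := 2) hrad (Eventually.of_forall fun m => le_rfl) (hξU n).locallyIntegrable
  have hac : μ.1 ≪ volume := hμ ▸ withDensity_absolutelyContinuous _ _
  have hpos : ∀ᵐ x ∂μ.1, 0 < ρ x := by
    rw [hμ, densityMeasure, ae_withDensity_iff (by fun_prop)]
    refine Eventually.of_forall fun x hx => ?_
    simpa using hx
  filter_upwards [hac.ae_le hleb, hpos, hd] with x hlebx hposx hdx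
  obtain ⟨n, hn⟩ := exists_nat_one_div_lt hposx
  have hxU : x ∈ U n := hn
  obtain ⟨r, hr, hball⟩ := Metric.isOpen_iff.1 (hU n) x hxU
  have hsupp : ∀ᶠ m in atTop, tsupport (fun y => mollifier m (x - y)) ⊆ U n := by
    filter_upwards [hrad.eventually_lt_const hr] with m hm
    refine Set.Subset.trans ?_ hball
    refine Set.Subset.trans (closure_minimal (t := Metric.closedBall x (κ m).rOut) ?_
      Metric.isClosed_closedBall) (Metric.closedBall_subset_ball hm)
    intro y hy
    have : x - y ∈ Function.support ((κ m).normed volume) := hy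
    rw [ContDiffBump.support_normed_eq, Metric.mem_ball, dist_zero_right] at this
    rw [Metric.mem_closedBall, dist_comm, dist_eq_norm]
    exact this.le
  have hweak : ∀ᶠ m in atTop, ∀ v,
      Integrable (fun y => φ y * fderiv ℝ (mollifier m : 𝔼 → ℝ) (x - y) v) ∧
        ∫ y, φ y * fderiv ℝ (mollifier m : 𝔼 → ℝ) (x - y) v =
          inner ℝ (convolution (mollifier m) ((U n).indicator ξ)
            (ContinuousLinearMap.lsmul ℝ ℝ) volume x) v := by
    filter_upwards [hsupp] with m hm v
    have hks := mollifier_contDiff (p := p) m (k := ⊤)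
    have hkd : Differentiable ℝ (mollifier m : 𝔼 → ℝ) := hks.differentiable (by norm_cast)
    have hkc := mollifier_hasCompactSupport (p := p) m
    obtain ⟨hi, he⟩ := hφ.integral_mul_fderiv hρ hρ0 hμ hF
      (h := fun y => mollifier m (x - y)) (hks.comp (contDiff_const.sub contDiff_id))
      (hasCompactSupport_comp_sub_left hkc x) (fun y => mollifier_nonneg m _)
      (hm.trans fun y (hy : 1 / (n + 1 : ℝ) < ρ y) => lt_trans (by positivity) hy) v
    simp_rw [fderiv_comp_sub_left _ hkd, mul_neg] at hi he
    rw [integral_neg, neg_inj] at he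
    refine ⟨by simpa using hi.neg, ?_⟩
    rw [he, convolution_eq_swap]
    simp only [ContinuousLinearMap.lsmul_apply]
    have hci : Integrable fun y => mollifier m (x - y) • (U n).indicator ξ y := by
      have := (hkc.convolutionExists_left (ContinuousLinearMap.lsmul ℝ ℝ) hks.continuous
        (hξU n).locallyIntegrable x).integrable_swap
      simpa using this
    rw [real_inner_comm, ← integral_inner hci]
    congr 1
    ext y
    by_cases hy : y ∈ U n
    · rw [Set.indicator_of_mem hy, inner_smul_right, real_inner_comm]
    · have : mollifier m (x - y) = 0 :=
        image_eq_zero_of_notMem_tsupport (f := fun y => mollifier m (x - y)) fun h => hy (hm h)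
      rw [this, zero_mul, zero_smul, inner_zero_right]
  refine ext_inner_right ℝ fun v => ?_
  rw [inner_gradient_eq_fderiv]
  have l1 : Tendsto (fun m => inner ℝ (convolution (mollifier m) ((U n).indicator ξ)
      (ContinuousLinearMap.lsmul ℝ ℝ) volume x) v) atTop (𝓝 (inner ℝ (ξ x) v)) := by
    have := (hlebx n).inner (𝕜 := ℝ) (tendsto_const_nhds (x := v))
    rwa [Set.indicator_of_mem hxU] at this
  have l2 : Tendsto (fun m => inner ℝ (convolution (mollifier m) ((U n).indicator ξ)
      (ContinuousLinearMap.lsmul ℝ ℝ) volume x) v) atTop (𝓝 (fderiv ℝ φ x v)) := by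
    rw [Metric.tendsto_nhds]
    intro ε hε
    filter_upwards [hweak, eventually_abs_integral_mul_fderiv_mollifier_sub_le hdx
      (ε := ε / (‖v‖ + 1)) (by positivity) (hweak.mono fun m hm v => (hm v).1)] with m hm1 hm2
    rw [Real.dist_eq, ← (hm1 v).2]
    refine (hm2 v).trans_lt ?_
    rw [div_mul_eq_mul_div, div_lt_iff₀ (by positivity)]
    gcongr
    linarith
  exact tendsto_nhds_unique l1 l2

end WassersteinGradient

theorem proposition1 {p : ℕ} (μ : P2 p) (F : P2 p → ℝ)
    (T : EuclideanSpace ℝ (Fin p) → EuclideanSpace ℝ (Fin p)) {K : NNReal}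
    (hT : LipschitzWith K T) (hdiff : ∀ᵐ x ∂μ.1, DifferentiableAt ℝ T x)
    (ξ : EuclideanSpace ℝ (Fin p) → EuclideanSpace ℝ (Fin p))
    (hξ : IsWassersteinGradient F (μ.map T hT) ξ) :
    IsWassersteinGradient (fun ν => F (ν.map T hT)) μ
        (fun x => ContinuousLinearMap.adjoint (fderiv ℝ T x) (ξ (T x))) ∧
      (∀ ζ : EuclideanSpace ℝ (Fin p) → EuclideanSpace ℝ (Fin p),
        IsWassersteinGradient (fun ν => F (ν.map T hT)) μ ζ →
          ∀ᵐ x ∂μ.1, ζ x = ContinuousLinearMap.adjoint (fderiv ℝ T x) (ξ (T x))) ∧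
      (∀ φ : EuclideanSpace ℝ (Fin p) → ℝ,
        IsFirstVariation F (μ.map T hT) φ →
        (∀ᵐ y ∂(μ.map T hT).1, DifferentiableAt ℝ φ y) →
        ((μ.map T hT).HasC1Density ∨ IsWassersteinGradient F (μ.map T hT) (gradient φ)) →
          ∀ᵐ x ∂μ.1, DifferentiableAt ℝ (φ ∘ T) x ∧
            ContinuousLinearMap.adjoint (fderiv ℝ T x) (ξ (T x)) = gradient (φ ∘ T) x) := by
  have main : IsWassersteinGradient (fun ν => F (ν.map T hT)) μ
      (fun x => ContinuousLinearMap.adjoint (fderiv ℝ T x) (ξ (T x))) :=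
    (hξ.isStrongGradient.comp_map hT hdiff).isWassersteinGradient
      (hξ.2.2.adjoint_fderiv hT hdiff)
  refine ⟨main, fun ζ hζ => hζ.ae_eq main, fun φ hφ hφd hor => ?_⟩
  have hae : ξ =ᵐ[(μ.map T hT).1] gradient φ := by
    rcases hor with ⟨ρ, hρ, hρ0, hμ⟩ | hg
    · exact hξ.isStrongGradient.ae_eq_gradient hρ.continuous hρ0 hμ hφ hφd
    · exact hξ.ae_eq hg
  have hTm : AEMeasurable T μ.1 := hT.continuous.measurable.aemeasurable
  filter_upwards [hdiff, ae_of_ae_map hTm hφd, ae_of_ae_map hTm hae] with x h1 h2 h3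
  exact ⟨h2.comp x h1, by rw [gradient_comp h1 h2, h3]⟩
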